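/- Consider the $O(N)^3$ tensor model of a real rank-3 tensor $\phi^{abc}$ with the single (prism) interaction $$\phi_1^{a_1b_1c_1}\phi_2^{a_1b_2c_2}\phi_3^{a_2b_2c_1}\phi_4^{a_2b_3c_3}\phi_5^{a_3b_3c_2}\phi_6^{a_3b_1c_3},$$ whose interaction graph is a triangular prism with the triangles $\{1,2,3\}$ and $\{6,5,4\}$, the rungs $16$, $25$, $34$, and edges of three colours, one for each kind of index ($a$: $12,34,56$; $b$: $23,45,61$; $c$: $13,25,46$). A vacuum diagram consists of finitely many prism vertices with a Wick contraction of all their fields in pairs (the pairs are the propagators), together with a number of closed propagators without vertices; diagrams are identified if they differ only by a bijection of the fields that respects the propagators and the coloured edges of the interaction vertices. For each colour, the index lines of that colour, which run alternately along propagators and edges of that colour of the vertices, form closed loops (a closed propagator without vertices counts as one loop of each colour); $f_{tot}$ is the total number of loops of the three colours. A connected vacuum diagram is maximal if no connected vacuum diagram with the same number of prism vertices has a larger $f_{tot}$. The empty diagram ($0$-cycle) is the connected diagram without vertices, i.e. one closed propagator. Consider the following three moves. 1. Elementary snail: replace a propagator by the two-point diagram obtained by cutting open one propagator of the diagram with one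 prism vertex and contractions $\langle 1,6\rangle,\langle 2,5\rangle,\langle 3,4\rangle$. 2. Elementary melon: replace a propagator by the two-point diagram obtained by cutting open one propagator of the diagram with two prism vertices $L,R$ and contractions $\langle i_L,i_R\rangle$, $i=1,\dots,6$. 3. Vertex expansion: replace a prism vertex by two prism vertices $L,R$ with contractions $\langle 1_L,1_R\rangle,\langle 2_L,2_R\rangle,\langle 3_L,3_R\rangle$, the remaining fields $6_L,5_L,4_L$ and $6_R,5_R,4_R$ taking over the external contractions of the fields $6,5,4$ and $1,2,3$, respectively, of the old vertex. Then a vacuum diagram is maximal if and only if it can be obtained from the empty diagram by finitely many of these moves. That is, every maximal vacuum diagram is generated from the empty diagram by elementary melons, elementary snails and vertex expansions, and all diagrams so produced are maximal. -/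

import Mathlib

/-- The three colours (one for each `O(N)` symmetry group). -/
abbrev PrismColour := Fin 3

/-- The six fields of a prism interaction.  The prism interaction graph is the skeleton of a
triangular prism: two triangles, joined by three rungs.  The field `(s, c)` is the corner of the
triangle `s` whose rung has colour `c`.  In the labelling in which the interaction is
`φ₁^{a₁b₁c₁} φ₂^{a₁b₂c₂} φ₃^{a₂b₂c₁} φ₄^{a₂b₃c₃} φ₅^{a₃b₃c₂} φ₆^{a₃b₁c₃}`, fields `1, 2, 3` are
`(false, 0), (false, 1), (false, 2)`, fields `6, 5, 4` are `(true, 0), (true, 1), (true, 2)`, and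
the colours of the indices `b, c, a` are `0, 1, 2`. -/
abbrev PrismField := Bool × PrismColour

/-- `prismPartner c x` is the field joined to `x` by the edge of colour `c` of the prism
interaction graph: the rung at `(s, c)` has colour `c`, and a triangle edge
joining the corners `(s, c₁)` and `(s, c₂)` has the third colour, `-(c₁ + c₂)` modulo `3`. -/
def prismPartner (c : PrismColour) (x : PrismField) : PrismField :=
  if x.2 = c then (!x.1, x.2) else (x.1, -(x.2 + c))

/-- A vacuum Feynman diagram (possibly disconnected) of the rank-3 prism theory: a finite set `V` of
prism vertices, a Wick contraction of all their fields in pairs, and a number `rings` of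
closed propagators without any vertex. -/
structure PrismDiagram where
  /-- the interaction vertices -/
  V : Type
  finite : Finite V
  /-- the field with which a given field is Wick-contracted -/
  contr : V × PrismField → V × PrismField
  contr_contr : ∀ x, contr (contr x) = x
  contr_ne : ∀ x, contr x ≠ x
  /-- the number of closed propagators without interaction vertices -/
  rings : ℕ

namespace PrismDiagram

attribute [instance] PrismDiagram.finite

/-- The fields of all the vertices of `D`, that is, the ends of its propagators. -/
abbrev HalfEdge (D : PrismDiagram) : Type := D.V × PrismField

/-- The number of interaction vertices. -/
noncomputable def numVertices (D : PrismDiagram) : ℕ := Nat.card D.V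

/-- Two fields are consecutive on an index line of colour `c`: they are joined
by a propagator, or by the edge of colour `c` of a prism vertex. -/
def Strand (D : PrismDiagram) (c : PrismColour) (x y : D.HalfEdge) : Prop :=
  y = D.contr x ∨ y = (x.1, prismPartner c x.2)

/-- The number of closed index loops of colour `c`. -/
noncomputable def loops (D : PrismDiagram) (c : PrismColour) : ℕ :=
  Nat.card (Quot (D.Strand c)) + D.rings

/-- The total number `f_total` of index loops, the power of `N` carried by the diagram. -/
noncomputable def totalLoops (D : PrismDiagram) : ℕ := ∑ c : PrismColour, D.loops c

/-- Two vertices are joined by a propagator. -/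
def Adj (D : PrismDiagram) (v w : D.V) : Prop :=
  ∃ i j : PrismField, D.contr (v, i) = (w, j)

/-- A diagram is connected if it has exactly one connected component. -/
def Connected (D : PrismDiagram) : Prop := Nat.card (Quot D.Adj) + D.rings = 1

/-- A maximal diagram: a connected vacuum diagram with the largest number of index loops among
all connected vacuum diagrams with the same number of interaction vertices. -/
def IsMaximal (D : PrismDiagram) : Prop :=
  D.Connected ∧ ∀ D' : PrismDiagram, D'.Connected → D'.numVertices = D.numVertices →
    D'.totalLoops ≤ D.totalLoops

/-- `D` and `D'` are the same multi-line diagram: a bijection between their fields respects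
propagators and the coloured edges of the interaction vertices (hence induces a bijection of
vertices, with an automorphism of the prism at each of them). -/
def Iso (D D' : PrismDiagram) : Prop :=
  D.rings = D'.rings ∧ ∃ e : D.HalfEdge ≃ D'.HalfEdge,
    (∀ x, e (D.contr x) = D'.contr (e x)) ∧
    ∀ (c : PrismColour) (x : D.HalfEdge),
      e (x.1, prismPartner c x.2) = ((e x).1, prismPartner c (e x).2)

/-- The diagram without interaction vertices: one closed propagator. -/
def zeroCycle : PrismDiagram where
  V := Empty
  finite := inferInstance
  contr := id
  contr_contr := fun _ => rfl
  contr_ne := fun x => x.1.elim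
  rings := 1

/-- The vacuum diagram with one prism vertex in which the two ends of each rung are contracted.
Cut open at any propagator it is an elementary snail. -/
def closedSnail : PrismDiagram where
  V := Unit
  finite := inferInstance
  contr := fun x => (x.1, (!x.2.1, x.2.2))
  contr_contr := by simp
  contr_ne := by
    rintro ⟨_, s, c⟩ h
    simp at h
  rings := 0

/-- The vacuum diagram with two prism vertices in which each field of one vertex is
contracted with the same field of the other.  Cut open at any propagator it is an elementary
melon. -/
def closedMelon : PrismDiagram where
  V := Bool
  finite := inferInstance
  contr := fun x => (!x.1, x.2)
  contr_contr := by simp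
  contr_ne := by
    rintro ⟨s, x⟩ h
    simp at h
  rings := 0

/-- Juxtaposition of two diagrams. -/
def union (D E : PrismDiagram) : PrismDiagram where
  V := D.V ⊕ E.V
  finite := inferInstance
  contr := fun x => match x with
    | (Sum.inl v, i) => (Sum.inl (D.contr (v, i)).1, (D.contr (v, i)).2)
    | (Sum.inr w, i) => (Sum.inr (E.contr (w, i)).1, (E.contr (w, i)).2)
  contr_contr := by
    rintro ⟨v | w, i⟩
    · simp [D.contr_contr]
    · simp [E.contr_contr]
  contr_ne := by
    rintro ⟨v | w, i⟩ h
    · simp only [Prod.mk.injEq, Sum.inl.injEq] at h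
      exact D.contr_ne (v, i) (Prod.ext h.1 h.2)
    · simp only [Prod.mk.injEq, Sum.inr.injEq] at h
      exact E.contr_ne (w, i) (Prod.ext h.1 h.2)
  rings := D.rings + E.rings

/-- Move the ends of the propagators along the permutation `π` of the fields: the propagator
that joined `x` and `y` now joins `π x` and `π y`. -/
def rewire (D : PrismDiagram) (π : Equiv.Perm D.HalfEdge) : PrismDiagram where
  V := D.V
  finite := D.finite
  contr := fun x => π (D.contr (π.symm x))
  contr_contr := by simp [D.contr_contr]
  contr_ne := by
    intro x h
    apply D.contr_ne (π.symm x)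
    exact (Equiv.eq_symm_apply π).2 h
  rings := D.rings

/-- The fields of `D`, as fields of `D.union E`. -/
def left {D : PrismDiagram} (E : PrismDiagram) (x : D.HalfEdge) : (D.union E).HalfEdge :=
  (Sum.inl x.1, x.2)

/-- The fields of `E`, as fields of `D.union E`. -/
def right (D : PrismDiagram) {E : PrismDiagram} (a : E.HalfEdge) : (D.union E).HalfEdge :=
  (Sum.inr a.1, a.2)

open Classical in
/-- Replace the propagator of `D` that joins `h` and `D.contr h` by the two-point diagram
obtained by cutting `E` open at the propagator that joins `a` and `E.contr a`: these two
propagators are replaced by a propagator that joins `h` and `a`, and one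
that joins `D.contr h` and `E.contr a`. -/
noncomputable def replaceEdge (D E : PrismDiagram) (h : D.HalfEdge) (a : E.HalfEdge) :
    PrismDiagram :=
  (D.union E).rewire (Equiv.swap (left E (D.contr h)) (right D a))

/-- Replace a closed propagator of `D` by the two-point diagram obtained by cutting `E` open at a
propagator: joining the two ends of the latter gives `E` back, so this
removes a closed propagator of `D` and adds `E`.  (Used only if `0 < D.rings`.) -/
def replaceRing (D E : PrismDiagram) : PrismDiagram :=
  { D.union E with rings := D.rings - 1 + E.rings }

open Classical in
/-- On the fields of `D` and of one more vertex: exchange the field `(false, c)` of the vertex `v`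
of `D` with the field `(true, c)` of the additional vertex, for each colour `c`. -/
noncomputable def exchange (D : PrismDiagram) (v : D.V) :
    (D.V ⊕ Unit) × PrismField → (D.V ⊕ Unit) × PrismField
  | (Sum.inl w, (false, c)) =>
      if w = v then (Sum.inr (), (true, c)) else (Sum.inl w, (false, c))
  | (Sum.inl w, (true, c)) => (Sum.inl w, (true, c))
  | (Sum.inr _, (false, c)) => (Sum.inr (), (false, c))
  | (Sum.inr _, (true, c)) => (Sum.inl v, (false, c))

theorem exchange_involutive (D : PrismDiagram) (v : D.V) :
    Function.Involutive (D.exchange v) := by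
  rintro ⟨w | _, s | s, c⟩
  · by_cases h : w = v <;> simp [exchange, h]
  · simp [exchange]
  · simp [exchange]
  · simp [exchange]

/-- Vertex expansion at the vertex `v` of `D`.  There is one new prism vertex `R`; the vertex `v`
keeps the external connections of its triangle `true`, the triangle `true` of `R` takes over those
of the triangle `false` of `v`, corner by corner, and the triangles `false` of `v` and `R` are
contracted with each other corner by corner.  (We start from `D` and a vertex `R` whose triangles
are contracted with each other, and exchange the propagator ends at `(v, (false, c))`
and `(R, (true, c))` for each colour `c`.) -/
noncomputable def expand (D : PrismDiagram) (v : D.V) : PrismDiagram :=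
  (D.union closedSnail).rewire (D.exchange_involutive v).toPerm

/-- The diagrams generated from the diagram without vertices by replacing propagators by
elementary snails, replacing propagators by elementary melons, and vertex expansion.  Diagrams are
considered up to the names of vertices and fields. -/
inductive Generated : PrismDiagram → Prop
  | zeroCycle : Generated zeroCycle
  | iso {D D' : PrismDiagram} : Generated D → Iso D D' → Generated D'
  | snail {D : PrismDiagram} (h : D.HalfEdge) (a : closedSnail.HalfEdge) :
      Generated D → Generated (D.replaceEdge closedSnail h a)
  | snailRing {D : PrismDiagram} :
      0 < D.rings → Generated D → Generated (D.replaceRing closedSnail)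
  | melon {D : PrismDiagram} (h : D.HalfEdge) (a : closedMelon.HalfEdge) :
      Generated D → Generated (D.replaceEdge closedMelon h a)
  | melonRing {D : PrismDiagram} :
      0 < D.rings → Generated D → Generated (D.replaceRing closedMelon)
  | expand {D : PrismDiagram} (v : D.V) : Generated D → Generated (D.expand v)

end PrismDiagram

open Module

set_option linter.unusedSectionVars false

/-! Cut each prism into its two triangles and complete each triangle to a tetrahedron by an
auxiliary field, joined to the corner `c` by an edge of colour `c`; the two auxiliary fields of a
prism are contracted with each other (`PrismDiagram.toTetra`). A rung becomes a path through the
auxiliary propagator, so the index loops are unchanged, and `v` prisms give `2v` tetrahedra with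
`4v` propagators.

For any two colours the tetrahedral diagram is a ribbon graph with four-valent vertices, whose faces
are the loops of these colours. Euler's inequality bounds their number by `2v + 2`; summing over the
three pairs gives `f_tot ≤ 3 + 3v` (`totalLoops_le`). Everything is done by linear algebra over
`ZMod 2`: numbers of loops are dimensions of spaces of functions on the fields, and equality in
Euler's inequality says that every even set of propagators is a sum of faces (`IsPlanar`).

Suppose that the bound is attained. Some loop then has fewer than four propagators, and planarity
makes all lengths even, so there is a loop of length two. Decomposed into loops of the other two
colours, it yields a curve through its two vertices: either a third propagator joins these vertices,
which is a melon, or both sides of the curve are two-point subdiagrams. Two-point subdiagrams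
inherit enough loops to repeat the argument, so the descent ends at a melon
(`IsConnected.hasMelon`).

Auxiliary fields are contracted only among themselves. Read in prisms, the melon is therefore a
vertex with at least two rungs contracted, which is a snail, or two vertices with triangles
contracted corner by corner, which is an expansion. Undoing this removes one vertex and three loops,
and induction on `v` applies (`generated_of_le`). It uses only snails and expansions, so elementary
melons are redundant as generators.

Conversely, all moves preserve `3 + 3v ≤ f_tot` (`Generated.connected_and_le`). As generated
diagrams exist for every `v`, maximality means attaining the bound. -/

/-- The third field of a vertex of the tetrahedral model: the corner `c` of a triangle is `some c`,
and the auxiliary field joined to the corner `c` by an edge of colour `c` is `none`. -/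
abbrev TetraField := Option (Fin 3)

/-- The edges of colour `c` of the tetrahedron. -/
def tetraPartner (c : Fin 3) : TetraField → TetraField
  | none => some c
  | some d => if d = c then none else some (-(d + c))

theorem tetraPartner_tetraPartner (c : Fin 3) (k : TetraField) :
    tetraPartner c (tetraPartner c k) = k := by
  revert c k; decide

theorem tetraPartner_ne (c : Fin 3) (k : TetraField) : tetraPartner c k ≠ k := by
  revert c k; decide

theorem tetraPartner_injective_colour {b c : Fin 3} {k : TetraField}
    (h : tetraPartner b k = tetraPartner c k) : b = c := by
  revert b c k; decide

theorem tetraPartner_comp {b c d : Fin 3} (hbc : b ≠ c) (hbd : b ≠ d) (hcd : c ≠ d)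
    (k : TetraField) : tetraPartner b (tetraPartner c k) = tetraPartner d k := by
  revert b c d k; decide

theorem tetraField_cases {b c d : Fin 3} (hbc : b ≠ c) (hbd : b ≠ d) (hcd : c ≠ d)
    (k l : TetraField) :
    l = k ∨ l = tetraPartner b k ∨ l = tetraPartner c k ∨ l = tetraPartner d k := by
  revert b c d k l; decide

/-! ### Parity and dimension over `ZMod 2` -/

theorem zmod_two_eq_zero_or_one (a : ZMod 2) : a = 0 ∨ a = 1 := by
  revert a; decide

/-- A space of functions that are determined by their values on `J` has dimension at
most the number of elements of `J`. -/
theorem finrank_le_card_of_vanish {ι : Type*} [Fintype ι]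
    (P : Submodule (ZMod 2) (ι → ZMod 2)) (J : Finset ι)
    (h : ∀ f ∈ P, (∀ j ∈ J, f j = 0) → f = 0) : finrank (ZMod 2) P ≤ J.card := by
  let φ : P →ₗ[ZMod 2] (J → ZMod 2) :=
    (LinearMap.funLeft (ZMod 2) (ZMod 2) (fun j : J => (j : ι))).comp P.subtype
  have hφ : Function.Injective φ := by
    rw [← LinearMap.ker_eq_bot, LinearMap.ker_eq_bot']
    intro f hf
    apply Subtype.ext
    exact h f.1 f.2 fun j hj => congrFun hf ⟨j, hj⟩
  simpa using LinearMap.finrank_le_finrank_of_injective hφ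

/-- A function with values in `ZMod 2` that is invariant under an involution without fixed
points has sum zero. -/
theorem sum_eq_zero_of_involution {ι : Type*} [DecidableEq ι] (s : Finset ι) (σ : ι → ι)
    (hσ : ∀ x, σ (σ x) = x) (hne : ∀ x, σ x ≠ x) (hs : ∀ x ∈ s, σ x ∈ s)
    (f : ι → ZMod 2) (hf : ∀ x ∈ s, f (σ x) = f x) : ∑ x ∈ s, f x = 0 :=
  Finset.sum_involution (fun x _ => σ x) (fun x hx => by rw [hf x hx, CharTwo.add_self_eq_zero])
    (fun x _ _ => hne x) (fun x hx => hs x hx) (fun x _ => hσ x)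

/-! ### Tetrahedral diagrams and their chains modulo two -/

/-- A Wick contraction of the fields of a set `T` of tetrahedra. -/
structure TetraDiagram (T : Type*) where
  /-- the field with which a given field is contracted -/
  contr : T × TetraField → T × TetraField
  contr_contr : ∀ x, contr (contr x) = x
  contr_ne : ∀ x, contr x ≠ x

namespace TetraDiagram

variable {T : Type*} [Fintype T] [DecidableEq T] (G : TetraDiagram T)

/-- The sets of propagators inside `S`, as functions modulo two on the fields. -/
def edgeFun (S : Finset T) : Submodule (ZMod 2) (T × TetraField → ZMod 2) where
  carrier := {h | (∀ x, h (G.contr x) = h x) ∧ ∀ x, x.1 ∉ S → h x = 0}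
  add_mem' := by
    rintro f g ⟨hf, hf'⟩ ⟨hg, hg'⟩
    exact ⟨fun x => by simp [hf, hg], fun x hx => by simp [hf' x hx, hg' x hx]⟩
  zero_mem' := ⟨fun _ => rfl, fun _ _ => rfl⟩
  smul_mem' := by
    rintro a f ⟨hf, hf'⟩
    exact ⟨fun x => by simp [hf], fun x hx => by simp [hf' x hx]⟩

/-- The sums modulo two of index loops of colour `c` inside `S`. -/
def loopFun (c : Fin 3) (S : Finset T) : Submodule (ZMod 2) (T × TetraField → ZMod 2) where
  carrier := {h | h ∈ G.edgeFun S ∧ ∀ t k, h (t, tetraPartner c k) = h (t, k)}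
  add_mem' := by
    rintro f g ⟨hf, hf'⟩ ⟨hg, hg'⟩
    exact ⟨add_mem hf hg, fun t k => by simp [hf', hg']⟩
  zero_mem' := ⟨zero_mem _, fun _ _ => rfl⟩
  smul_mem' := by
    rintro a f ⟨hf, hf'⟩
    exact ⟨Submodule.smul_mem _ _ hf, fun t k => by simp [hf']⟩

/-- The diagram is connected: a function on the vertices modulo two that is
constant along propagators is constant. -/
def IsConnected : Prop :=
  ∀ g : T → ZMod 2, (∀ x, g (G.contr x).1 = g x.1) → ∀ s t, g s = g t

theorem loopFun_le_edgeFun (c : Fin 3) (S : Finset T) : G.loopFun c S ≤ G.edgeFun S :=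
  fun _ h => h.1

/-- A set of vertices and a set of propagators are paired by counting the ends of the latter at
the former. -/
def pairing (S : Finset T) : (T → ZMod 2) →ₗ[ZMod 2] Dual (ZMod 2) (G.edgeFun S) :=
  LinearMap.mk₂ (ZMod 2) (fun g h => ∑ x, h.1 x * g x.1)
    (fun g g' h => by simp [mul_add, Finset.sum_add_distrib])
    (fun a g h => by simp [Finset.mul_sum]; congr 1; ext x; ring)
    (fun g h h' => by simp [add_mul, Finset.sum_add_distrib])
    (fun a g h => by simp [Finset.mul_sum, mul_assoc])

theorem pairing_apply (S : Finset T) (g : T → ZMod 2) (h : G.edgeFun S) :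
    G.pairing S g h = ∑ x, h.1 x * g x.1 := rfl

/-- At each vertex the fields on a loop come in pairs exchanged by `tetraPartner c`, so a loop has
an even number of ends there: it is a cycle. -/
theorem pairing_loopFun (S : Finset T) (g : T → ZMod 2) (c : Fin 3)
    {h : T × TetraField → ZMod 2} (hh : h ∈ G.loopFun c S) :
    G.pairing S g ⟨h, hh.1⟩ = 0 := by
  rw [pairing_apply]
  refine sum_eq_zero_of_involution _ (fun x => (x.1, tetraPartner c x.2))
    (fun x => by simp [tetraPartner_tetraPartner]) (fun x hx => ?_) (by simp) _ (fun x _ => ?_)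
  · exact tetraPartner_ne c x.2 (congrArg Prod.snd hx)
  · simp only; rw [hh.2]

open Classical in
theorem indicator_edge_mem (S : Finset T) {x : T × TetraField} (hx : x.1 ∈ S)
    (hx' : (G.contr x).1 ∈ S) :
    (fun y => if y = x ∨ y = G.contr x then (1 : ZMod 2) else 0) ∈ G.edgeFun S := by
  refine ⟨fun y => ?_, fun y hy => ?_⟩
  · refine if_congr ?_ rfl rfl
    constructor
    · rintro (h | h)
      · exact .inr (by rw [← h, G.contr_contr])
      · exact .inl (by rw [← G.contr_contr y, h, G.contr_contr])
    · rintro (rfl | rfl)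
      · exact .inr rfl
      · exact .inl (G.contr_contr x)
  · refine if_neg ?_
    rintro (rfl | rfl) <;> contradiction

theorem eq_of_pairing_eq_zero (S : Finset T) {g : T → ZMod 2} (hg : G.pairing S g = 0)
    {x : T × TetraField} (hx : x.1 ∈ S) (hx' : (G.contr x).1 ∈ S) :
    g (G.contr x).1 = g x.1 := by
  classical
  have h := LinearMap.congr_fun hg ⟨_, G.indicator_edge_mem S hx hx'⟩
  rw [pairing_apply] at h
  simp only [ite_mul, one_mul, zero_mul, LinearMap.zero_apply] at h
  rw [← Finset.sum_filter, show (Finset.univ.filter fun y => y = x ∨ y = G.contr x)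
    = {x, G.contr x} by ext; simp, Finset.sum_pair (G.contr_ne x).symm] at h
  rw [CharTwo.add_eq_zero] at h
  exact h.symm

/-! ### Euler's inequality by duality -/

section Euler

variable {S : Finset T} {s₀ : T} {b c : Fin 3}

/-- This is the rank of the coboundary of a connected graph: the kernel consists of functions
constant on `S` and arbitrary outside, so its dimension is at most `1 + |Sᶜ|`. -/
theorem card_le_finrank_range_pairing (hs₀ : s₀ ∈ S)
    (hS : ∀ g : T → ZMod 2, (∀ x, x.1 ∈ S → (G.contr x).1 ∈ S → g (G.contr x).1 = g x.1) →
      ∀ t ∈ S, g t = g s₀) :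
    S.card ≤ finrank (ZMod 2) (LinearMap.range (G.pairing S)) + 1 := by
  have h1 := LinearMap.finrank_range_add_finrank_ker (G.pairing S)
  have h2 : finrank (ZMod 2) (LinearMap.ker (G.pairing S)) ≤ (insert s₀ Sᶜ).card := by
    apply finrank_le_card_of_vanish
    intro g hg hz
    ext t
    by_cases ht : t ∈ S
    · rw [hS g (fun x hx hx' => G.eq_of_pairing_eq_zero S hg hx hx') t ht]
      exact hz _ (by simp)
    · exact hz _ (by simp [ht])
  rw [Finset.card_insert_of_notMem (by simpa using hs₀)] at h2
  have h3 := Finset.card_add_card_compl S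
  simp only [finrank_fintype_fun_eq_card] at h1
  omega

theorem range_pairing_le (S : Finset T) (b c : Fin 3) :
    LinearMap.range (G.pairing S) ≤
      ((G.loopFun b S ⊔ G.loopFun c S).submoduleOf (G.edgeFun S)).dualAnnihilator := by
  rintro _ ⟨g, rfl⟩
  rw [Submodule.mem_dualAnnihilator]
  rintro ⟨h, hh⟩ hm
  change h ∈ G.loopFun b S ⊔ G.loopFun c S at hm
  obtain ⟨f, hf, f', hf', rfl⟩ := Submodule.mem_sup.1 hm
  have : (⟨f + f', hh⟩ : G.edgeFun S) = ⟨f, hf.1⟩ + ⟨f', hf'.1⟩ := rfl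
  rw [this, map_add, G.pairing_loopFun S g b hf, G.pairing_loopFun S g c hf', add_zero]

theorem finrank_dualAnnihilator_loops (S : Finset T) (b c : Fin 3) :
    finrank (ZMod 2) (G.loopFun b S) + finrank (ZMod 2) (G.loopFun c S) +
      finrank (ZMod 2)
        ((G.loopFun b S ⊔ G.loopFun c S).submoduleOf (G.edgeFun S)).dualAnnihilator =
    finrank (ZMod 2) (G.edgeFun S) +
      finrank (ZMod 2) (G.loopFun b S ⊓ G.loopFun c S : Submodule _ _) := by
  have h1 := Submodule.finrank_sup_add_finrank_inf_eq (G.loopFun b S) (G.loopFun c S)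
  have h2 := Subspace.finrank_add_finrank_dualAnnihilator_eq
    ((G.loopFun b S ⊔ G.loopFun c S).submoduleOf (G.edgeFun S))
  have h3 := (Submodule.submoduleOfEquivOfLe (sup_le (G.loopFun_le_edgeFun b S)
    (G.loopFun_le_edgeFun c S))).finrank_eq
  omega

/-- Euler's inequality for the ribbon graph of two of the three colours. -/
theorem finrank_loopFun_add_le (hs₀ : s₀ ∈ S)
    (hS : ∀ g : T → ZMod 2, (∀ x, x.1 ∈ S → (G.contr x).1 ∈ S → g (G.contr x).1 = g x.1) →
      ∀ t ∈ S, g t = g s₀) (b c : Fin 3) :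
    finrank (ZMod 2) (G.loopFun b S) + finrank (ZMod 2) (G.loopFun c S) + S.card ≤
    finrank (ZMod 2) (G.edgeFun S) +
      finrank (ZMod 2) (G.loopFun b S ⊓ G.loopFun c S : Submodule _ _) + 1 := by
  have h1 := G.card_le_finrank_range_pairing hs₀ hS
  have h2 := Submodule.finrank_mono (G.range_pairing_le S b c)
  have h3 := G.finrank_dualAnnihilator_loops S b c
  omega

/-- If Euler's inequality is an equality, then a set of propagators with an even number of ends at
each vertex is a sum of index loops of the two colours. -/
theorem mem_sup_of_finrank_le (hs₀ : s₀ ∈ S)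
    (hS : ∀ g : T → ZMod 2, (∀ x, x.1 ∈ S → (G.contr x).1 ∈ S → g (G.contr x).1 = g x.1) →
      ∀ t ∈ S, g t = g s₀)
    (heq : finrank (ZMod 2) (G.edgeFun S) +
      finrank (ZMod 2) (G.loopFun b S ⊓ G.loopFun c S : Submodule _ _) + 1 ≤
      finrank (ZMod 2) (G.loopFun b S) + finrank (ZMod 2) (G.loopFun c S) + S.card)
    {h : T × TetraField → ZMod 2} (hh : h ∈ G.edgeFun S) (ht : ∀ t, ∑ k, h (t, k) = 0) :
    h ∈ G.loopFun b S ⊔ G.loopFun c S := by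
  have h1 := G.card_le_finrank_range_pairing hs₀ hS
  have h3 := G.finrank_dualAnnihilator_loops S b c
  -- Equality of dimensions turns the inclusion "coboundaries annihilate faces" into an equality. A
  -- cycle is killed by all coboundaries, hence by the whole annihilator, and so lies in the span of
  -- the faces.
  have h4 := Submodule.eq_of_le_of_finrank_le (G.range_pairing_le S b c) (by omega)
  have h5 : (⟨h, hh⟩ : G.edgeFun S) ∈
      (G.loopFun b S ⊔ G.loopFun c S).submoduleOf (G.edgeFun S) := by
    rw [← Subspace.dualAnnihilator_dualCoannihilator_eq
      (W := (G.loopFun b S ⊔ G.loopFun c S).submoduleOf (G.edgeFun S)), ← h4,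
      Submodule.mem_dualCoannihilator]
    rintro _ ⟨g, rfl⟩
    rw [pairing_apply, Fintype.sum_prod_type]
    refine Finset.sum_eq_zero fun t _ => ?_
    simp only
    rw [← Finset.sum_mul, ht, zero_mul]
  exact h5

end Euler

/-- The number of propagators inside `S` is half of the number of their ends. -/
theorem finrank_edgeFun_le (S : Finset T) :
    2 * finrank (ZMod 2) (G.edgeFun S) ≤
      (Finset.univ.filter fun x => x.1 ∈ S ∧ (G.contr x).1 ∈ S).card := by
  classical
  set e := Fintype.equivFin (T × TetraField)
  set Y := Finset.univ.filter fun x => x.1 ∈ S ∧ (G.contr x).1 ∈ S with hY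
  -- An enumeration of the fields selects one end of each propagator.
  set J := Y.filter fun x => e x < e (G.contr x) with hJ
  set J' := Y.filter fun x => ¬ e x < e (G.contr x) with hJ'
  have h1 : finrank (ZMod 2) (G.edgeFun S) ≤ J.card := by
    apply finrank_le_card_of_vanish
    rintro f ⟨hf, hf'⟩ hz
    ext x
    by_cases h : x.1 ∈ S
    · by_cases h' : (G.contr x).1 ∈ S
      · rcases lt_trichotomy (e x) (e (G.contr x)) with hl | hl | hl
        · exact hz x (by simp [hJ, hY, h, h', hl])
        · exact absurd (e.injective hl).symm (G.contr_ne x)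
        · rw [← hf]
          exact hz _ (by simp [hJ, hY, h, h', G.contr_contr, hl])
      · rw [← hf]
        exact hf' _ h'
    · exact hf' _ h
  have h2 : J.card ≤ J'.card := by
    refine Finset.card_le_card_of_injOn G.contr ?_ ?_
    · intro x hx
      simp only [hJ, hY, Finset.coe_filter, Finset.mem_filter, Finset.mem_univ, true_and,
        Set.mem_ofPred_eq] at hx
      simp [hJ', hY, hx, G.contr_contr, hx.2.le]
    · intro x _ y _ h
      rw [← G.contr_contr x, h, G.contr_contr]
  have h3 : J.card + J'.card = Y.card := Finset.card_filter_add_card_filter_not _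
  omega

theorem sum_eq_zero_of_loop {c : Fin 3} {h : T × TetraField → ZMod 2}
    (hh : ∀ t k, h (t, tetraPartner c k) = h (t, k)) (S : Finset T) :
    ∑ x with x.1 ∈ S, h x = 0 :=
  sum_eq_zero_of_involution _ (fun x => (x.1, tetraPartner c x.2))
    (fun x => by simp [tetraPartner_tetraPartner])
    (fun x hx => tetraPartner_ne c x.2 (congrArg Prod.snd hx)) (by simp) _
    (fun x _ => hh x.1 x.2)

end TetraDiagram

theorem exists_third_colour (b c : Fin 3) : ∃ d : Fin 3, b ≠ d ∧ c ≠ d := by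
  revert b c; decide

theorem sum_tetraField {M : Type*} [AddCommMonoid M] {b c d : Fin 3} (hbc : b ≠ c) (hbd : b ≠ d)
    (hcd : c ≠ d) (k : TetraField) (f : TetraField → M) :
    ∑ l, f l = f k + (f (tetraPartner b k) + (f (tetraPartner c k) + f (tetraPartner d k))) := by
  have h : (Finset.univ : Finset TetraField)
      = {k, tetraPartner b k, tetraPartner c k, tetraPartner d k} := by
    revert b c d k; decide
  rw [h, Finset.sum_insert, Finset.sum_insert, Finset.sum_insert, Finset.sum_singleton]
  all_goals clear h; revert b c d k; simp only [Finset.mem_insert, Finset.mem_singleton]; decide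

/-! ### Connected tetrahedral diagrams and planarity -/

namespace TetraDiagram

variable {T : Type*} [Fintype T] [DecidableEq T] {G : TetraDiagram T}

theorem eq_of_loops {b c : Fin 3} (hbc : b ≠ c) {f : T × TetraField → ZMod 2} {t : T}
    (hb : ∀ k, f (t, tetraPartner b k) = f (t, k))
    (hc : ∀ k, f (t, tetraPartner c k) = f (t, k)) (k l : TetraField) : f (t, l) = f (t, k) := by
  obtain ⟨d, hbd, hcd⟩ := exists_third_colour b c
  rcases tetraField_cases hbc hbd hcd k l with rfl | rfl | rfl | rfl
  · rfl
  · exact hb k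
  · exact hc k
  · rw [← tetraPartner_comp hbc hbd hcd, hb, hc]

theorem IsConnected.eq_of_loops (hG : G.IsConnected) {b c : Fin 3} (hbc : b ≠ c) {S : Finset T}
    {f : T × TetraField → ZMod 2}
    (hf : f ∈ (G.loopFun b S ⊓ G.loopFun c S : Submodule _ _)) (x y : T × TetraField) :
    f x = f y := by
  obtain ⟨⟨⟨hα, hS⟩, hb⟩, -, hc⟩ := hf
  have key : ∀ t k l, f (t, l) = f (t, k) := fun t => TetraDiagram.eq_of_loops hbc (hb t) (hc t)
  have := hG (fun t => f (t, none)) (fun z => by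
    rw [key _ (G.contr z).2 none, key z.1 z.2 none]
    exact hα z) x.1 y.1
  calc f x = f (x.1, none) := key x.1 none x.2
    _ = f (y.1, none) := this
    _ = f y := key y.1 y.2 none

/-- Edges of two colours connect all four fields of a tetrahedron, so a function invariant for both
colours is constant on the connected diagram. This is the relation that the sum of all faces of one
colour equals that of the other. -/
theorem IsConnected.finrank_inf_univ_le (hG : G.IsConnected) [Nonempty T] {b c : Fin 3}
    (hbc : b ≠ c) (S : Finset T) :
    finrank (ZMod 2) (G.loopFun b S ⊓ G.loopFun c S : Submodule _ _) ≤ 1 := by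
  obtain ⟨t⟩ := ‹Nonempty T›
  refine finrank_le_card_of_vanish _ {(t, none)} fun f hf hz => ?_
  ext x
  rw [hG.eq_of_loops hbc hf x (t, none)]
  exact hz _ (by simp)

/-- The only candidate is a constant, which vanishes outside `S`. The unit gained here is needed in
the bound for two-point subdiagrams. -/
theorem IsConnected.finrank_inf_eq_zero (hG : G.IsConnected) {b c : Fin 3}
    (hbc : b ≠ c) {S : Finset T} {t : T} (ht : t ∉ S) :
    finrank (ZMod 2) (G.loopFun b S ⊓ G.loopFun c S : Submodule _ _) = 0 := by
  refine Nat.le_zero.1 (finrank_le_card_of_vanish _ ∅ fun f hf _ => ?_)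
  ext x
  rw [hG.eq_of_loops hbc hf x (t, none)]
  exact hf.1.1.2 _ ht

theorem card_fields (S : Finset T) :
    (Finset.univ.filter fun x : T × TetraField => x.1 ∈ S).card = 4 * S.card := by
  rw [show (Finset.univ.filter fun x : T × TetraField => x.1 ∈ S) = S ×ˢ Finset.univ by
    ext; simp]
  simp [Finset.card_product, mul_comm]

theorem finrank_edgeFun_univ_le (G : TetraDiagram T) :
    finrank (ZMod 2) (G.edgeFun Finset.univ) ≤ 2 * Fintype.card T := by
  have h := G.finrank_edgeFun_le Finset.univ
  have h2 := card_fields (Finset.univ : Finset T)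
  simp only [Finset.mem_univ, and_self] at h h2
  rw [h2, Finset.card_univ] at h
  omega

/-- Euler's inequality with `|T|` vertices and at most `2|T|` propagators. -/
theorem IsConnected.finrank_loopFun_add_le (hG : G.IsConnected) [Nonempty T] {b c : Fin 3}
    (hbc : b ≠ c) :
    finrank (ZMod 2) (G.loopFun b Finset.univ) + finrank (ZMod 2) (G.loopFun c Finset.univ) ≤
      Fintype.card T + 2 := by
  obtain ⟨t⟩ := ‹Nonempty T›
  have h1 := G.finrank_loopFun_add_le (Finset.mem_univ t)
    (fun g hg s _ => hG g (fun x => hg x (by simp) (by simp)) s t) b c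
  have h2 := G.finrank_edgeFun_univ_le
  have h3 := hG.finrank_inf_univ_le (hbc := hbc) (S := Finset.univ)
  rw [Finset.card_univ] at h1
  omega

/-- The ribbon graph of any two of the three colours is planar. -/
def IsPlanar (G : TetraDiagram T) : Prop :=
  ∀ b c : Fin 3, b ≠ c → ∀ h ∈ G.edgeFun Finset.univ, (∀ t, ∑ k, h (t, k) = 0) →
    h ∈ G.loopFun b Finset.univ ⊔ G.loopFun c Finset.univ

/-- The hypothesis is the sum of the three pairwise Euler bounds with the inequality reversed, so
each of them is an equality. -/
theorem IsConnected.isPlanar (hG : G.IsConnected) [Nonempty T]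
    (h : 3 * Fintype.card T + 6 ≤
      2 * ∑ c : Fin 3, finrank (ZMod 2) (G.loopFun c Finset.univ)) : G.IsPlanar := by
  intro b c hbc f hf hf'
  obtain ⟨t⟩ := ‹Nonempty T›
  refine G.mem_sup_of_finrank_le (Finset.mem_univ t)
    (fun g hg s _ => hG g (fun x => hg x (by simp) (by simp)) s t) ?_ hf hf'
  have h2 := G.finrank_edgeFun_univ_le
  have h3 := hG.finrank_inf_univ_le (hbc := hbc) (S := Finset.univ)
  have h01 := hG.finrank_loopFun_add_le (show (0 : Fin 3) ≠ 1 by decide)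
  have h02 := hG.finrank_loopFun_add_le (show (0 : Fin 3) ≠ 2 by decide)
  have h12 := hG.finrank_loopFun_add_le (show (1 : Fin 3) ≠ 2 by decide)
  rw [Fin.sum_univ_three] at h
  rw [Finset.card_univ]
  have : Fintype.card T + 2 ≤ finrank (ZMod 2) (G.loopFun b Finset.univ) +
      finrank (ZMod 2) (G.loopFun c Finset.univ) := by
    fin_cases b <;> fin_cases c <;> first | exact absurd rfl hbc | (simp only [Fin.zero_eta, Fin.mk_one, Fin.reduceFinMk]; omega)
  omega

/-! ### Two-point subdiagrams -/

/-- Exactly two propagators leave `S`, from the fields `u` and `w`. -/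
structure IsCut (G : TetraDiagram T) (S : Finset T) (u w : T × TetraField) : Prop where
  ne : u ≠ w
  left_mem : u.1 ∈ S
  right_mem : w.1 ∈ S
  contr_left : (G.contr u).1 ∉ S
  contr_right : (G.contr w).1 ∉ S
  inner : ∀ x, x.1 ∈ S → x ≠ u → x ≠ w → (G.contr x).1 ∈ S

namespace IsCut

variable {S : Finset T} {u w : T × TetraField}

theorem compl (h : G.IsCut S u w) : G.IsCut Sᶜ (G.contr u) (G.contr w) where
  ne := fun he => h.ne (by rw [← G.contr_contr u, he, G.contr_contr])
  left_mem := by simpa using h.contr_left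
  right_mem := by simpa using h.contr_right
  contr_left := by simpa [G.contr_contr] using h.left_mem
  contr_right := by simpa [G.contr_contr] using h.right_mem
  inner := by
    intro x hx hu hw
    rw [Finset.mem_compl] at hx ⊢
    intro hx'
    apply hx
    rw [← G.contr_contr x]
    refine h.inner _ hx' ?_ ?_
    · rintro rfl; exact hu (G.contr_contr x).symm
    · rintro rfl; exact hw (G.contr_contr x).symm

theorem inner_fields (h : G.IsCut S u w) :
    (Finset.univ.filter fun x : T × TetraField => x.1 ∈ S)
      = insert u (insert w (Finset.univ.filter fun x => x.1 ∈ S ∧ (G.contr x).1 ∈ S)) := by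
  ext x
  simp only [Finset.mem_filter, Finset.mem_univ, true_and, Finset.mem_insert]
  constructor
  · intro hx
    by_cases hu : x = u
    · exact .inl hu
    by_cases hw : x = w
    · exact .inr (.inl hw)
    exact .inr (.inr ⟨hx, h.inner x hx hu hw⟩)
  · rintro (rfl | rfl | hx)
    exacts [h.left_mem, h.right_mem, hx.1]

theorem card_inner (h : G.IsCut S u w) :
    (Finset.univ.filter fun x => x.1 ∈ S ∧ (G.contr x).1 ∈ S).card + 2 = 4 * S.card := by
  rw [← card_fields, h.inner_fields, Finset.card_insert_of_notMem, Finset.card_insert_of_notMem]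
  · simp [h.contr_right]
  · simp [h.ne, h.contr_left]

/-- The two ends of an inner propagator cancel in the sum over the fields of `S`; only `u` and `w`
remain. -/
theorem eq_of_sum_eq_zero (h : G.IsCut S u w) {f : T × TetraField → ZMod 2}
    (hf : ∀ x, x.1 ∈ S → (G.contr x).1 ∈ S → f (G.contr x) = f x)
    (hs : ∑ x with x.1 ∈ S, f x = 0) : f w = f u := by
  rw [h.inner_fields, Finset.sum_insert, Finset.sum_insert,
    sum_eq_zero_of_involution _ G.contr G.contr_contr G.contr_ne, add_zero, CharTwo.add_eq_zero]
    at hs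
  · exact hs.symm
  · intro x hx
    simp only [Finset.mem_filter, Finset.mem_univ, true_and, G.contr_contr] at hx ⊢
    exact hx.symm
  · intro x hx
    simp only [Finset.mem_filter, Finset.mem_univ, true_and] at hx
    exact hf x hx.1 hx.2
  · simp [h.contr_right]
  · simp [h.ne, h.contr_left]

/-- A two-point part of a connected diagram is connected by itself. Each vertex has an even number
of fields, so parity gives `g` the same value at both exits, and `g` extends to the rest of the
diagram by that value. -/
theorem eq_of_inner (hG : G.IsConnected) (h : G.IsCut S u w) {g : T → ZMod 2}
    (hg : ∀ x, x.1 ∈ S → (G.contr x).1 ∈ S → g (G.contr x).1 = g x.1) :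
    ∀ t ∈ S, g t = g u.1 := by
  have huw : g w.1 = g u.1 := h.eq_of_sum_eq_zero (f := fun x => g x.1) hg
    (sum_eq_zero_of_loop (c := 0) (by simp) S)
  have key : ∀ x, x.1 ∈ S → (G.contr x).1 ∉ S → g x.1 = g u.1 := by
    intro x hx hx'
    by_cases hu : x = u
    · rw [hu]
    by_cases hw : x = w
    · rw [hw, huw]
    exact absurd (h.inner x hx hu hw) hx'
  intro t ht
  have := hG (fun t => if t ∈ S then g t else g u.1) (fun x => by
    by_cases hx : x.1 ∈ S <;> by_cases hx' : (G.contr x).1 ∈ S <;> simp only [hx, hx', if_true, if_false]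
    · exact hg x hx hx'
    · exact (key x hx hx').symm
    · exact key _ hx' (by rwa [G.contr_contr])) t (G.contr u).1
  simpa [ht, h.contr_left] using this

/-- At most one loop of each colour crosses the cut: by parity, a sum of loops that avoids `u` also
avoids `w`, and then it splits into its parts in `S` and in `Sᶜ`. -/
theorem finrank_loopFun_le (h : G.IsCut S u w) (c : Fin 3) :
    finrank (ZMod 2) (G.loopFun c Finset.univ) ≤
      finrank (ZMod 2) (G.loopFun c S) + finrank (ZMod 2) (G.loopFun c Sᶜ) + 1 := by
  -- Vanishing at `u` has codimension at most one; this is the `+ 1`.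
  let K := LinearMap.ker (LinearMap.proj (R := ZMod 2) (φ := fun _ : T × TetraField => ZMod 2) u)
  have h1 := LinearMap.finrank_range_add_finrank_ker
    (LinearMap.proj (R := ZMod 2) (φ := fun _ : T × TetraField => ZMod 2) u)
  change _ + finrank (ZMod 2) K = _ at h1
  have h2 := Submodule.finrank_le (LinearMap.range
    (LinearMap.proj (R := ZMod 2) (φ := fun _ : T × TetraField => ZMod 2) u))
  have h3 := Submodule.finrank_sup_add_finrank_inf_eq (G.loopFun c Finset.univ) K
  have h4 := Submodule.finrank_le (G.loopFun c Finset.univ ⊔ K)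
  have h5 : (G.loopFun c Finset.univ ⊓ K : Submodule _ _) ≤ G.loopFun c S ⊔ G.loopFun c Sᶜ := by
    rintro f ⟨⟨⟨hα, -⟩, hc⟩, hu⟩
    replace hu : f u = 0 := hu
    have hw : f w = 0 := by
      rw [h.eq_of_sum_eq_zero (fun x _ _ => hα x) (sum_eq_zero_of_loop hc S), hu]
    have key : ∀ x, x.1 ∈ S → (G.contr x).1 ∉ S → f x = 0 := by
      intro x hx hx'
      by_cases h1 : x = u
      · rw [h1, hu]
      by_cases h2 : x = w
      · rw [h2, hw]
      exact absurd (h.inner x hx h1 h2) hx'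
    refine Submodule.mem_sup.2 ⟨fun x => if x.1 ∈ S then f x else 0,
      ⟨⟨fun x => ?_, fun x hx => if_neg hx⟩, fun t k => by simp [hc]⟩,
      fun x => if x.1 ∈ S then 0 else f x,
      ⟨⟨fun x => ?_, fun x hx => if_pos (by simpa using hx)⟩, fun t k => by simp [hc]⟩, ?_⟩
    · by_cases hx : x.1 ∈ S <;> by_cases hx' : (G.contr x).1 ∈ S <;> simp only [hx, hx', if_true, if_false]
      · exact hα x
      · exact (key x hx hx').symm
      · exact key _ hx' (by rwa [G.contr_contr])
    · by_cases hx : x.1 ∈ S <;> by_cases hx' : (G.contr x).1 ∈ S <;> simp only [hx, hx', if_true, if_false]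
      · rw [hα]; exact key x hx hx'
      · rw [← hα]; exact (key _ hx' (by rwa [G.contr_contr])).symm
      · exact hα x
    · ext x
      by_cases hx : x.1 ∈ S <;> simp [hx]
  have h6 := Submodule.finrank_mono h5
  have h7 := Submodule.finrank_add_le_finrank_add_finrank (G.loopFun c S) (G.loopFun c Sᶜ)
  simp only [finrank_self] at h2
  omega

/-- Euler's inequality for `S`, which has at most `2|S| - 1` inner propagators and no common
invariant function of the two colours. -/
theorem finrank_loopFun_add_le (hG : G.IsConnected) (h : G.IsCut S u w) {b c : Fin 3}
    (hbc : b ≠ c) :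
    finrank (ZMod 2) (G.loopFun b S) + finrank (ZMod 2) (G.loopFun c S) ≤ S.card := by
  have h1 := G.finrank_loopFun_add_le h.left_mem (fun g hg => h.eq_of_inner hG hg) b c
  have h2 := hG.finrank_inf_eq_zero hbc h.contr_left
  have h3 := G.finrank_edgeFun_le S
  have h4 := h.card_inner
  omega

/-- The complement carries at most `3|Sᶜ|/2` loops and at most three loops cross the cut; the
remaining ones lie inside `S`. -/
theorem le_sum_finrank_loopFun (hG : G.IsConnected) (h : G.IsCut S u w)
    (hF : 3 * Fintype.card T + 6 ≤
      2 * ∑ c : Fin 3, finrank (ZMod 2) (G.loopFun c Finset.univ)) :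
    3 * S.card ≤ 2 * ∑ c : Fin 3, finrank (ZMod 2) (G.loopFun c S) := by
  have h0 := h.finrank_loopFun_le 0
  have h1 := h.finrank_loopFun_le 1
  have h2 := h.finrank_loopFun_le 2
  have h01 := h.compl.finrank_loopFun_add_le hG (show (0 : Fin 3) ≠ 1 by decide)
  have h02 := h.compl.finrank_loopFun_add_le hG (show (0 : Fin 3) ≠ 2 by decide)
  have h12 := h.compl.finrank_loopFun_add_le hG (show (1 : Fin 3) ≠ 2 by decide)
  have hc := Finset.card_add_card_compl S
  rw [Fin.sum_univ_three] at hF ⊢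
  omega

end IsCut

/-! ### Short loops -/

/-- If there are many loops of colour `c` inside `S`, then there is a short one. -/
theorem exists_short_loop (G : TetraDiagram T) {S : Finset T} {c : Fin 3}
    (hlt : (Finset.univ.filter fun x => x.1 ∈ S ∧ (G.contr x).1 ∈ S).card <
      8 * finrank (ZMod 2) (G.loopFun c S)) :
    ∃ h ∈ G.loopFun c S, h ≠ 0 ∧ (Finset.univ.filter fun x => h x ≠ 0).card < 8 := by
  classical
  by_contra! hcon
  let r : T × TetraField → T × TetraField → Prop :=
    fun x y => y = G.contr x ∨ y = (x.1, tetraPartner c x.2)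
  let mk : T × TetraField → Quot r := Quot.mk r
  have hα : ∀ x, mk (G.contr x) = mk x := fun x => (Quot.sound (.inl rfl)).symm
  have hc : ∀ t k, mk (t, tetraPartner c k) = mk (t, k) :=
    fun t k => (Quot.sound (.inr rfl)).symm
  have : Fintype (Quot r) := Fintype.ofFinite _
  -- `Q` is the set of single loops of colour `c` lying inside `S`. They have disjoint supports, so
  -- if each had at least eight fields there would be too many inner fields.
  set Q : Finset (Quot r) := Finset.univ.filter fun q => ∀ x, mk x = q → x.1 ∈ S with hQ
  have h1 : finrank (ZMod 2) (G.loopFun c S) ≤ (Q.image Quot.out).card := by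
    apply finrank_le_card_of_vanish
    rintro f ⟨⟨hf, hf'⟩, hfc⟩ hz
    let F : Quot r → ZMod 2 := Quot.lift f (by
      rintro x y (rfl | rfl)
      · exact (hf x).symm
      · exact (hfc x.1 x.2).symm)
    have hF : ∀ x y, mk x = mk y → f x = f y := fun x y h => congrArg F h
    ext x
    by_cases hx : mk x ∈ Q
    · rw [hF x (mk x).out (Quot.out_eq _).symm]
      exact hz _ (Finset.mem_image_of_mem _ hx)
    · simp only [hQ, Finset.mem_filter, Finset.mem_univ, true_and, not_forall] at hx
      obtain ⟨y, hy, hy'⟩ := hx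
      rw [← hF y x hy]
      exact hf' y hy'
  have h2 : ∀ q ∈ Q, 8 ≤ ((Finset.univ.filter fun x => mk x ∈ Q).filter fun x => mk x = q).card := by
    intro q hq
    have hq' := (Finset.mem_filter.1 hq).2
    have := hcon (fun x => if mk x = q then 1 else 0)
      ⟨⟨fun x => by simp only [hα], fun x hx => if_neg fun h => hx (hq' x h)⟩,
        fun t k => by simp only [hc]⟩ (fun h => by
        obtain ⟨x, rfl⟩ := Quot.exists_rep q
        simpa [mk] using congrFun h x)
    refine this.trans (Finset.card_le_card fun x hx => ?_)
    simp only [Finset.mem_filter, Finset.mem_univ, true_and, ne_eq, ite_eq_right_iff,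
      one_ne_zero, imp_false, not_not] at hx ⊢
    exact ⟨hx ▸ hq, hx⟩
  have h3 := Finset.card_eq_sum_card_fiberwise
    (s := Finset.univ.filter fun x => mk x ∈ Q) (t := Q) (f := mk) (by
      intro x hx; simpa using hx)
  have h4 := Finset.sum_le_sum h2
  have h5 : (Finset.univ.filter fun x => mk x ∈ Q).card ≤
      (Finset.univ.filter fun x => x.1 ∈ S ∧ (G.contr x).1 ∈ S).card := by
    refine Finset.card_le_card fun x hx => ?_
    simp only [hQ, Finset.mem_filter, Finset.mem_univ, true_and] at hx ⊢
    exact ⟨hx x rfl, hx _ (hα x)⟩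
  have h6 : (Q.image Quot.out).card ≤ Q.card := Finset.card_image_le
  rw [Finset.sum_const, smul_eq_mul] at h4
  omega

end TetraDiagram

/-- This is the count at one vertex: a sum of loops of colour `d` takes each of the values `p, q` on
two fields, one of colour `e` takes each of `r, s` on two fields, and the hypothesis makes `p + q +
r + s` even. -/
theorem four_dvd_of_add_eq_add : ∀ p q r s : ZMod 2, q + s = p + r →
    4 ∣ p.val + r.val + (q.val + s.val + (p.val + s.val + (q.val + r.val))) := by
  decide

namespace TetraDiagram

variable {T : Type*} [Fintype T] [DecidableEq T] {G : TetraDiagram T}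

/-- An elementary melon: two vertices `t` and `t'` with three pairs of corresponding fields
contracted, all but those reached along the edges of colour `m`. -/
def HasMelon (G : TetraDiagram T) : Prop :=
  ∃ (t t' : T) (k k' : TetraField) (m : Fin 3), t ≠ t' ∧ G.contr (t, k) = (t', k') ∧
    ∀ c, c ≠ m → G.contr (t, tetraPartner c k) = (t', tetraPartner c k')

theorem card_support_eq_sum {ι : Type*} [Fintype ι] (f : ι → ZMod 2) :
    (Finset.univ.filter fun x => f x ≠ 0).card = ∑ x, (f x).val := by
  rw [Finset.card_filter]
  refine Finset.sum_congr rfl fun x _ => ?_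
  rcases zmod_two_eq_zero_or_one (f x) with h | h <;> simp [h, ZMod.val_one]

/-- In a planar diagram the index loops have even length. -/
theorem IsPlanar.four_dvd_card (hG : G.IsPlanar) {c : Fin 3} {h : T × TetraField → ZMod 2}
    (hh : h ∈ G.loopFun c Finset.univ) : 4 ∣ (Finset.univ.filter fun x => h x ≠ 0).card := by
  obtain ⟨d, e, hcd, hce, hde⟩ : ∃ d e : Fin 3, c ≠ d ∧ c ≠ e ∧ d ≠ e := by
    clear hh; revert c; decide
  obtain ⟨f, hf, f', hf', rfl⟩ := Submodule.mem_sup.1 (hG d e hde h hh.1 (fun t => by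
    rw [sum_tetraField hcd hce hde none, hh.2,
      ← tetraPartner_comp hcd hce hde, hh.2, ← add_assoc, CharTwo.add_self_eq_zero,
      CharTwo.add_self_eq_zero, add_zero]))
  rw [card_support_eq_sum]
  -- The common support is a set of whole propagators, so its number of fields is even.
  have h1 : 2 ∣ (Finset.univ.filter fun x => f x * f' x ≠ 0).card := by
    rw [← ZMod.natCast_eq_zero_iff, Finset.card_eq_sum_ones, Nat.cast_sum]
    refine sum_eq_zero_of_involution _ G.contr G.contr_contr G.contr_ne ?_ _ (fun _ _ => rfl)
    intro x hx
    simpa [hf.1.1 x, hf'.1.1 x] using hx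
  rw [card_support_eq_sum] at h1
  -- Inclusion-exclusion for a symmetric difference. The overlap counts twice an even number, so
  -- only the local counts matter modulo four.
  have h2 : ∑ x, ((f + f') x).val + 2 * ∑ x, (f x * f' x).val
      = ∑ x, ((f x).val + (f' x).val) := by
    rw [Finset.mul_sum, ← Finset.sum_add_distrib]
    refine Finset.sum_congr rfl fun x _ => ?_
    simp only [Pi.add_apply]
    generalize f x = p
    generalize f' x = q
    revert p q; decide
  have h3 : 4 ∣ ∑ x, ((f x).val + (f' x).val) := by
    rw [Fintype.sum_prod_type]
    refine Finset.dvd_sum fun t _ => ?_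
    have e1 := hf.2 t none
    have e2 := hf.2 t (tetraPartner e none)
    have e3 := hf'.2 t none
    have e4 := hf'.2 t (tetraPartner d none)
    have e5 := hh.2 t none
    rw [tetraPartner_comp hde hcd.symm hce.symm] at e2
    rw [tetraPartner_comp hde.symm hce.symm hcd.symm] at e4
    rw [sum_tetraField hcd hce hde none]
    simp only [Pi.add_apply, e1, e2, e3, e4] at e5 ⊢
    exact four_dvd_of_add_eq_add _ _ _ _ e5
  omega

theorem mem_loopFun_pair {c : Fin 3} {x : T × TetraField}
    (hx : G.contr x = (x.1, tetraPartner c x.2)) :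
    (fun y => if y = x ∨ y = G.contr x then (1 : ZMod 2) else 0)
      ∈ G.loopFun c Finset.univ := by
  refine ⟨?_, fun t k => if_congr ?_ rfl rfl⟩
  · convert G.indicator_edge_mem Finset.univ (Finset.mem_univ x.1) (Finset.mem_univ _)
  · rw [hx]
    obtain ⟨s, l⟩ := x
    simp only [Prod.mk.injEq]
    constructor
    · rintro (⟨rfl, h⟩ | ⟨rfl, h⟩)
      · exact .inr ⟨rfl, by rw [← h, tetraPartner_tetraPartner]⟩
      · exact .inl ⟨rfl, by rw [← tetraPartner_tetraPartner c k, h, tetraPartner_tetraPartner]⟩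
    · rintro (⟨rfl, rfl⟩ | ⟨rfl, rfl⟩)
      · exact .inr ⟨rfl, rfl⟩
      · exact .inl ⟨rfl, tetraPartner_tetraPartner _ _⟩

/-- In a planar diagram the shortest possible loops have length two. -/
theorem IsPlanar.loop_of_length_two (hG : G.IsPlanar) {c : Fin 3} {S : Finset T}
    {h : T × TetraField → ZMod 2} (hh : h ∈ G.loopFun c S)
    (h0 : h ≠ 0) (h8 : (Finset.univ.filter fun x => h x ≠ 0).card < 8) :
    ∃ x : T × TetraField, x.1 ∈ S ∧ (G.contr x).1 ∈ S ∧
      G.contr (x.1, tetraPartner c x.2) =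
        ((G.contr x).1, tetraPartner c (G.contr x).2) ∧
      G.contr x ≠ (x.1, tetraPartner c x.2) := by
  have hS : ∀ x, h x ≠ 0 → x.1 ∈ S := fun x hx => by
    by_contra hx'; exact hx (hh.1.2 x hx')
  have hh' : h ∈ G.loopFun c Finset.univ := ⟨⟨hh.1.1, by simp⟩, hh.2⟩
  obtain ⟨x, hx⟩ : ∃ x, h x ≠ 0 := by
    by_contra! hcon; exact h0 (funext hcon)
  have hxα : h (G.contr x) ≠ 0 := by rwa [hh.1.1]
  have hxc : h (x.1, tetraPartner c x.2) ≠ 0 := by rwa [hh.2]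
  -- A loop of length one would have two fields, against divisibility by four.
  have hne : G.contr x ≠ (x.1, tetraPartner c x.2) := by
    intro he
    have h1 := hG.four_dvd_card (mem_loopFun_pair he)
    rw [show (Finset.univ.filter fun y => (if y = x ∨ y = G.contr x then (1 : ZMod 2) else 0) ≠ 0)
      = {x, G.contr x} by ext; simp; tauto, Finset.card_pair (G.contr_ne x).symm] at h1
    omega
  refine ⟨x, hS x hx, hS _ hxα, ?_, hne⟩
  have h4 : (Finset.univ.filter fun x => h x ≠ 0).card = 4 := by
    have h1 := hG.four_dvd_card hh'
    have h2 : 0 < (Finset.univ.filter fun x => h x ≠ 0).card :=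
      Finset.card_pos.2 ⟨x, by simpa using hx⟩
    omega
  set p : T × TetraField → T × TetraField := fun y => (y.1, tetraPartner c y.2) with hp
  have pp : ∀ y, p (p y) = y := fun y => by simp [hp, tetraPartner_tetraPartner]
  have pne : ∀ y, p y ≠ y := fun y hy => tetraPartner_ne c y.2 (congrArg Prod.snd hy)
  change G.contr (p x) = p (G.contr x)
  change G.contr x ≠ p x at hne
  have h5 : ({x, p x, G.contr x, p (G.contr x)} : Finset _) =
      Finset.univ.filter fun x => h x ≠ 0 := by
    refine Finset.eq_of_subset_of_card_le ?_ ?_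
    · intro y hy
      simp only [Finset.mem_insert, Finset.mem_singleton] at hy
      simp only [Finset.mem_filter, Finset.mem_univ, true_and]
      rcases hy with rfl | rfl | rfl | rfl
      · exact hx
      · exact hxc
      · exact hxα
      · simp only [hp]; rw [hh.2]; exact hxα
    · rw [h4, Finset.card_insert_of_notMem, Finset.card_insert_of_notMem, Finset.card_pair]
      · exact (pne _).symm
      · simp only [Finset.mem_insert, Finset.mem_singleton, not_or]
        refine ⟨hne.symm, fun he => ?_⟩
        apply G.contr_ne x
        rw [← pp (G.contr x), ← he, pp]
      · simp only [Finset.mem_insert, Finset.mem_singleton, not_or]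
        refine ⟨(pne x).symm, (G.contr_ne x).symm, fun he => hne ?_⟩
        rw [← pp (G.contr x), ← he]
  have h6 : G.contr (p x) ∈ ({x, p x, G.contr x, p (G.contr x)} : Finset _) := by
    rw [h5]
    simp only [Finset.mem_filter, Finset.mem_univ, true_and]
    rwa [hh.1.1]
  simp only [Finset.mem_insert, Finset.mem_singleton] at h6
  rcases h6 with h6 | h6 | h6 | h6
  · exact absurd ((congrArg G.contr h6).symm.trans (G.contr_contr _)) hne
  · exact absurd h6 (G.contr_ne _)
  · have : p x = x := by rw [← G.contr_contr (p x), h6, G.contr_contr]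
    exact absurd this (pne x)
  · exact h6

/-! ### Length-two loops: melons or separations -/

/-- The vertices other than `t` and `t'` on one side of a separating curve through these two
vertices and two propagators between them. -/
theorem isCut_of_separating {t t' : T} {k k' : TetraField} {c d e : Fin 3} (hcd : c ≠ d)
    (hce : c ≠ e) (hde : d ≠ e) (htt' : t ≠ t')
    (hk : G.contr (t, k) = (t', k'))
    (f : T × TetraField → ZMod 2) (hα : ∀ x, f (G.contr x) = f x)
    (hf : ∀ s, s ≠ t → s ≠ t' → ∀ l, f (s, l) = f (s, none))
    (h1 : f (t, tetraPartner d k) = 1) (h2 : f (t, tetraPartner c k) = 0)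
    (h3 : f (t, tetraPartner e k) = 0)
    (h1' : f (t', tetraPartner d k') = 1) (h2' : f (t', tetraPartner c k') = 0)
    (h3' : f (t', tetraPartner e k') = 0)
    (hne : G.contr (t, tetraPartner d k) ≠ (t', tetraPartner d k')) :
    G.IsCut (Finset.univ.filter fun s => s ≠ t ∧ s ≠ t' ∧ f (s, none) = 1)
      (G.contr (t, tetraPartner d k)) (G.contr (t', tetraPartner d k')) := by
  have hk' : G.contr (t', k') = (t, k) := by rw [← hk, G.contr_contr]
  have hs : ∀ l, f (t, l) = 1 → l = k ∨ l = tetraPartner d k := by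
    intro l hl
    rcases tetraField_cases hcd hce hde k l with h | h | h | h
    · exact .inl h
    · rw [h, h2] at hl; exact absurd hl zero_ne_one
    · exact .inr h
    · rw [h, h3] at hl; exact absurd hl zero_ne_one
  have hs' : ∀ l, f (t', l) = 1 → l = k' ∨ l = tetraPartner d k' := by
    intro l hl
    rcases tetraField_cases hcd hce hde k' l with h | h | h | h
    · exact .inl h
    · rw [h, h2'] at hl; exact absurd hl zero_ne_one
    · exact .inr h
    · rw [h, h3'] at hl; exact absurd hl zero_ne_one
  have hmem : ∀ x : T × TetraField, x.1 ∈ (Finset.univ.filter fun s => s ≠ t ∧ s ≠ t' ∧ f (s, none) = 1)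
      ↔ x.1 ≠ t ∧ x.1 ≠ t' ∧ f x = 1 := by
    rintro ⟨s, l⟩
    simp only [Finset.mem_filter, Finset.mem_univ, true_and]
    constructor
    · rintro ⟨ha, hb, hc⟩
      exact ⟨ha, hb, by rw [hf s ha hb, hc]⟩
    · rintro ⟨ha, hb, hc⟩
      exact ⟨ha, hb, by rw [← hf s ha hb l, hc]⟩
  have aux : ∀ x, (G.contr x).1 = t → f x = 1 → x = (t', k') ∨ x = G.contr (t, tetraPartner d k) := by
    intro x hx hfx
    rw [← hα] at hfx
    obtain ⟨l, hl⟩ : ∃ l, G.contr x = (t, l) := ⟨_, Prod.ext hx rfl⟩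
    rw [hl] at hfx
    rw [← G.contr_contr x, hl]
    rcases hs l hfx with rfl | rfl
    · exact .inl hk
    · exact .inr rfl
  have aux' : ∀ x, (G.contr x).1 = t' → f x = 1 → x = (t, k) ∨ x = G.contr (t', tetraPartner d k') := by
    intro x hx hfx
    rw [← hα] at hfx
    obtain ⟨l, hl⟩ : ∃ l, G.contr x = (t', l) := ⟨_, Prod.ext hx rfl⟩
    rw [hl] at hfx
    rw [← G.contr_contr x, hl]
    rcases hs' l hfx with rfl | rfl
    · exact .inl hk'
    · exact .inr rfl
  refine ⟨fun he => ?_, ?_, ?_, ?_, ?_, ?_⟩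
  · have : (t, tetraPartner d k) = (t', tetraPartner d k') := by
      rw [← G.contr_contr (t, tetraPartner d k), he, G.contr_contr]
    exact htt' (congrArg Prod.fst this)
  · rw [hmem]
    refine ⟨fun h => ?_, fun h => ?_, by rw [hα, h1]⟩
    · rcases aux _ h h1 with h | h
      · exact htt' (congrArg Prod.fst h)
      · exact G.contr_ne _ h.symm
    · rcases aux' _ h h1 with h | h
      · exact tetraPartner_ne d k (congrArg Prod.snd h)
      · exact hne (by rw [h, G.contr_contr])
  · rw [hmem]
    refine ⟨fun h => ?_, fun h => ?_, by rw [hα, h1']⟩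
    · rcases aux _ h h1' with h | h
      · exact tetraPartner_ne d k' (congrArg Prod.snd h)
      · exact hne h.symm
    · rcases aux' _ h h1' with h | h
      · exact htt' (congrArg Prod.fst h).symm
      · exact G.contr_ne _ h.symm
  · rw [hmem, G.contr_contr]
    exact fun h => h.1 rfl
  · rw [hmem, G.contr_contr]
    exact fun h => h.2.1 rfl
  · intro x hx hu hw
    rw [hmem] at hx ⊢
    obtain ⟨hx1, hx2, hx3⟩ := hx
    refine ⟨fun h => ?_, fun h => ?_, by rw [hα, hx3]⟩
    · rcases aux x h hx3 with rfl | h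
      · exact hx2 rfl
      · exact hu h
    · rcases aux' x h hx3 with rfl | h
      · exact hx1 rfl
      · exact hw h

/-- A loop of length two in a planar diagram belongs to a melon or separates the diagram. -/
theorem IsPlanar.hasMelon_or_isCut (hG : G.IsPlanar) {c : Fin 3} {t t' : T} {k k' : TetraField}
    (htt' : t ≠ t') (hk : G.contr (t, k) = (t', k'))
    (hc : G.contr (t, tetraPartner c k) = (t', tetraPartner c k')) :
    G.HasMelon ∨ ∃ (M N : Finset T) (u w u' w' : T × TetraField),
      G.IsCut M u w ∧ G.IsCut N u' w' ∧ t ∉ M ∧ t ∉ N ∧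
      (∀ s, s ≠ t → s ≠ t' → (s ∈ M ↔ s ∉ N)) ∧
      ∀ x, x.1 ∈ M → (G.contr x).1 ∈ M ∨ (G.contr x).1 = t ∨ (G.contr x).1 = t' := by
  have hk' : G.contr (t', k') = (t, k) := by rw [← hk, G.contr_contr]
  have hc' : G.contr (t', tetraPartner c k') = (t, tetraPartner c k) := by
    rw [← hc, G.contr_contr]
  set h : T × TetraField → ZMod 2 := fun x =>
    if x = (t, k) ∨ x = (t', k') ∨ x = (t, tetraPartner c k) ∨ x = (t', tetraPartner c k')
    then 1 else 0 with hdef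
  have hα : ∀ x, h (G.contr x) = h x := by
    intro x
    refine if_congr ?_ rfl rfl
    have e : ∀ y, G.contr x = y ↔ x = G.contr y := fun y =>
      ⟨fun h => by rw [← h, G.contr_contr], fun h => by rw [h, G.contr_contr]⟩
    simp only [e, hk, hk', hc, hc']
    tauto
  have hcinv : ∀ s l, h (s, tetraPartner c l) = h (s, l) := by
    intro s l
    refine if_congr ?_ rfl rfl
    have e : ∀ m, tetraPartner c l = m ↔ l = tetraPartner c m := fun y =>
      ⟨fun h => by rw [← h, tetraPartner_tetraPartner], fun h => by
        rw [h, tetraPartner_tetraPartner]⟩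
    simp only [Prod.mk.injEq, e, tetraPartner_tetraPartner]
    tauto
  obtain ⟨d, e, hcd, hce, hde⟩ : ∃ d e : Fin 3, c ≠ d ∧ c ≠ e ∧ d ≠ e := by
    clear * -; revert c; decide
  have hev : ∀ s, ∑ l, h (s, l) = 0 := fun s => by
    rw [sum_tetraField hcd hce hde none, hcinv, ← tetraPartner_comp hcd hce hde, hcinv,
      ← add_assoc, CharTwo.add_self_eq_zero, CharTwo.add_self_eq_zero, add_zero]
  have pne : ∀ {a b : Fin 3} {l : TetraField}, a ≠ b → tetraPartner a l ≠ tetraPartner b l :=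
    fun hab he => hab (tetraPartner_injective_colour he)
  have v1 : h (t, k) = 1 := by simp [hdef]
  have v2 : h (t, tetraPartner c k) = 1 := by simp [hdef]
  have v3 : h (t, tetraPartner d k) = 0 := by
    simp [hdef, htt', tetraPartner_ne, pne hcd.symm]
  have v4 : h (t, tetraPartner e k) = 0 := by
    simp [hdef, htt', tetraPartner_ne, pne hce.symm]
  have v1' : h (t', k') = 1 := by simp [hdef]
  have v3' : h (t', tetraPartner d k') = 0 := by
    simp [hdef, htt'.symm, tetraPartner_ne, pne hcd.symm]
  have v4' : h (t', tetraPartner e k') = 0 := by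
    simp [hdef, htt'.symm, tetraPartner_ne, pne hce.symm]
  have v0 : ∀ s, s ≠ t → s ≠ t' → ∀ l, h (s, l) = 0 := by
    intro s hs hs' l
    simp [hdef, hs, hs']
  clear_value h
  -- By planarity the length-two loop `h` is a sum of loops of the other two colours; these are
  -- named so that the `d`-part `f` contains the propagator at `k`. At both vertices `f` then
  -- occupies exactly the fields `k` and `tetraPartner d k`, and `g` the fields `tetraPartner c k`
  -- and `tetraPartner d k`, with `k'` for `k` at `t'`.
  obtain ⟨d, e, hcd, hce, hde, v3, v4, v3', v4', f, hf, g, hg, hfg, hfx⟩ :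
      ∃ d e : Fin 3, c ≠ d ∧ c ≠ e ∧ d ≠ e ∧
        h (t, tetraPartner d k) = 0 ∧ h (t, tetraPartner e k) = 0 ∧
        h (t', tetraPartner d k') = 0 ∧ h (t', tetraPartner e k') = 0 ∧
        ∃ f ∈ G.loopFun d Finset.univ, ∃ g ∈ G.loopFun e Finset.univ, f + g = h ∧
          f (t, k) = 1 := by
    obtain ⟨f, hf, g, hg, hfg⟩ := Submodule.mem_sup.1 (hG d e hde h ⟨hα, by simp⟩ hev)
    rcases zmod_two_eq_zero_or_one (f (t, k)) with h0 | h1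
    · refine ⟨e, d, hce, hcd, hde.symm, v4, v3, v4', v3', g, hg, f, hf, by rw [add_comm, hfg], ?_⟩
      have := congrFun hfg (t, k)
      simpa [h0, v1] using this
    · exact ⟨d, e, hcd, hce, hde, v3, v4, v3', v4', f, hf, g, hg, hfg, h1⟩
  have sum : ∀ x, f x + g x = h x := fun x => congrFun hfg x
  have hfx' : f (t', k') = 1 := by rw [← hk, hf.1.1, hfx]
  have hgx : g (t, k) = 0 := by
    have := sum (t, k); rw [hfx, v1] at this; simpa using this
  have hgx' : g (t', k') = 0 := by
    have := sum (t', k'); rw [hfx', v1'] at this; simpa using this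
  have f1 : f (t, tetraPartner d k) = 1 := by rw [hf.2, hfx]
  have g1 : g (t, tetraPartner e k) = 0 := by rw [hg.2, hgx]
  have f3 : f (t, tetraPartner e k) = 0 := by
    have := sum (t, tetraPartner e k); rw [g1, v4] at this; simpa using this
  have f2 : f (t, tetraPartner c k) = 0 := by
    rw [← tetraPartner_comp hde hcd.symm hce.symm, hf.2, f3]
  have g3 : g (t, tetraPartner d k) = 1 := by
    have := sum (t, tetraPartner d k); rw [f1, v3, CharTwo.add_eq_zero] at this; exact this.symm
  have g2 : g (t, tetraPartner c k) = 1 := by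
    rw [← tetraPartner_comp hde.symm hce.symm hcd.symm, hg.2, g3]
  have f1' : f (t', tetraPartner d k') = 1 := by rw [hf.2, hfx']
  have g1' : g (t', tetraPartner e k') = 0 := by rw [hg.2, hgx']
  have f3' : f (t', tetraPartner e k') = 0 := by
    have := sum (t', tetraPartner e k'); rw [g1', v4'] at this; simpa using this
  have f2' : f (t', tetraPartner c k') = 0 := by
    rw [← tetraPartner_comp hde hcd.symm hce.symm, hf.2, f3']
  have g3' : g (t', tetraPartner d k') = 1 := by
    have := sum (t', tetraPartner d k'); rw [f1', v3', CharTwo.add_eq_zero] at this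
    exact this.symm
  have g2' : g (t', tetraPartner c k') = 1 := by
    rw [← tetraPartner_comp hde.symm hce.symm hcd.symm, hg.2, g3']
  have off : ∀ s, s ≠ t → s ≠ t' → ∀ l, f (s, l) = g (s, l) := by
    intro s hs hs' l
    have := sum (s, l)
    rwa [v0 s hs hs', CharTwo.add_eq_zero] at this
  -- Away from `t` and `t'` the functions `f` and `g` agree, so `f` is invariant for two colours and
  -- constant at each vertex. Its two values are the two sides of the separating curve.
  have hfconst : ∀ s, s ≠ t → s ≠ t' → ∀ l, f (s, l) = f (s, none) := by
    intro s hs hs' l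
    refine eq_of_loops hde (hf.2 s) (fun m => ?_) none l
    rw [off s hs hs', off s hs hs', hg.2]
  -- A third direct propagator between `t` and `t'` makes a melon. Without one on a given side, the
  -- propagators leaving the third fields are the two exits of that side.
  by_cases hm : G.contr (t, tetraPartner d k) = (t', tetraPartner d k')
  · refine .inl ⟨t, t', k, k', e, htt', hk, fun a ha => ?_⟩
    obtain rfl | rfl : a = c ∨ a = d := by
      clear * - ha hcd hce hde; revert a c d e; decide
    · exact hc
    · exact hm
  by_cases hm' : G.contr (t, tetraPartner e k) = (t', tetraPartner e k')
  · refine .inl ⟨t, t', k, k', d, htt', hk, fun a ha => ?_⟩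
    obtain rfl | rfl : a = c ∨ a = e := by
      clear * - ha hcd hce hde; revert a c d e; decide
    · exact hc
    · exact hm'
  have cutM := isCut_of_separating hcd hce hde htt' hk f hf.1.1 hfconst f1 f2 f3 f1' f2' f3' hm
  -- The function `1 + g` describes the opposite side: at `t` it is one exactly on `k` and
  -- `tetraPartner e k`, so `d` and `e` exchange roles.
  have cutN := isCut_of_separating hce hcd hde.symm htt' hk (fun x => 1 + g x)
    (fun x => by simp only [hg.1.1])
    (fun s hs hs' l => by
      rw [← off s hs hs', ← off s hs hs', hfconst s hs hs'])
    (by simp [g1]) (by simp [g2, CharTwo.add_self_eq_zero])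
    (by simp [g3, CharTwo.add_self_eq_zero]) (by simp [g1'])
    (by simp [g2', CharTwo.add_self_eq_zero]) (by simp [g3', CharTwo.add_self_eq_zero]) hm'
  refine .inr ⟨_, _, _, _, _, _, cutM, cutN, by simp, by simp, fun s hs hs' => ?_, fun x hx => ?_⟩
  · simp only [Finset.mem_filter, Finset.mem_univ, true_and, hs, hs', ne_eq, not_false_eq_true,
      ← off s hs hs' none]
    rcases zmod_two_eq_zero_or_one (f (s, none)) with h | h <;> simp [h]
  · simp only [Finset.mem_filter, Finset.mem_univ, true_and] at hx ⊢
    by_cases h1 : (G.contr x).1 = t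
    · exact .inr (.inl h1)
    by_cases h2 : (G.contr x).1 = t'
    · exact .inr (.inr h2)
    refine .inl ⟨h1, h2, ?_⟩
    rw [← hfconst _ h1 h2 (G.contr x).2]
    change f (G.contr x) = 1
    rw [hf.1.1, ← hx.2.2]
    exact hfconst _ hx.1 hx.2.1 _

/-! ### Descent through two-point subdiagrams to a melon -/

theorem IsConnected.hasMelon_of_isCut (hG : G.IsConnected)
    (hF : 3 * Fintype.card T + 6 ≤
      2 * ∑ c : Fin 3, finrank (ZMod 2) (G.loopFun c Finset.univ))
    (heven : Even (Fintype.card T)) (n : ℕ) :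
    ∀ S : Finset T, S.card = n → S.Nonempty → (S = Finset.univ ∨ ∃ u w, G.IsCut S u w) →
      G.HasMelon := by
  induction n using Nat.strong_induction_on with
  | _ n ih =>
  rintro S hn ⟨s₀, hs₀⟩ hS
  have : Nonempty T := ⟨s₀⟩
  have hP := hG.isPlanar hF
  -- Averaging over the colours: three times the number of inner fields is at most `12|S|` and falls
  -- strictly below eight times the number of loops inside `S`, by the `+ 6` for the whole diagram
  -- and by the two missing fields for a cut.
  obtain ⟨c, hc⟩ : ∃ c, (Finset.univ.filter fun x => x.1 ∈ S ∧ (G.contr x).1 ∈ S).card <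
      8 * finrank (ZMod 2) (G.loopFun c S) := by
    by_contra! hcon
    have h0 := hcon 0
    have h1 := hcon 1
    have h2 := hcon 2
    rw [Fin.sum_univ_three] at hF
    rcases hS with rfl | ⟨u, w, hS⟩
    · have h3 := card_fields (Finset.univ : Finset T)
      simp only [Finset.mem_univ, and_self] at h0 h1 h2 h3
      rw [Finset.card_univ (α := T)] at h3
      omega
    · have h3 := hS.card_inner
      have h4 := hS.le_sum_finrank_loopFun hG (by rw [Fin.sum_univ_three]; exact hF)
      rw [Fin.sum_univ_three] at h4
      omega
  obtain ⟨h, hh, h0, h8⟩ := G.exists_short_loop hc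
  obtain ⟨⟨t, k⟩, ht, ht', hαc, hne⟩ := hP.loop_of_length_two hh h0 h8
  obtain ⟨⟨t', k'⟩, hk⟩ : ∃ y, G.contr (t, k) = y := ⟨_, rfl⟩
  rw [hk] at ht' hαc hne
  simp only at ht ht' hαc hne
  -- If both propagators returned to one tetrahedron, they would use up all its fields. It would be
  -- the whole diagram, against the even number of vertices.
  have htt' : t ≠ t' := by
    rintro rfl
    have hk' : G.contr (t, k') = (t, k) := by rw [← hk, G.contr_contr]
    have hαc' : G.contr (t, tetraPartner c k') = (t, tetraPartner c k) := by
      rw [← hαc, G.contr_contr]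
    have hkk' : k' ≠ k := by
      rintro rfl; exact G.contr_ne _ hk
    have hkc : k' ≠ tetraPartner c k := fun h => hne (by rw [h])
    have hall : ∀ l, (G.contr (t, l)).1 = t := by
      intro l
      have : l = k ∨ l = tetraPartner c k ∨ l = k' ∨ l = tetraPartner c k' := by
        clear * - hkk' hkc; revert c k k' l; decide
      rcases this with rfl | rfl | rfl | rfl
      · rw [hk]
      · rw [hαc]
      · rw [hk']
      · rw [hαc']
    have hone : ∀ s, s = t := by
      intro s
      by_contra hs
      have := hG (fun s => if s = t then 1 else 0) (fun x => by
        refine if_congr ⟨fun h => ?_, fun h => ?_⟩ rfl rfl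
        · rw [← G.contr_contr x, ← Prod.mk.eta (p := G.contr x), h, hall]
        · rw [← Prod.mk.eta (p := x), h, hall]) s t
      simp [hs] at this
    have : Fintype.card T = 1 := Fintype.card_eq_one_iff.2 ⟨t, hone⟩
    rw [this] at heven
    exact absurd heven (by decide)
  rcases hP.hasMelon_or_isCut htt' hk hαc with hm | ⟨M, N, u, w, u', w', hM, hN, htM, htN, hMN, hcl⟩
  · exact hm
  have hdesc : ∀ L : Finset T, (∃ u w, G.IsCut L u w) → t ∉ L → L ⊆ S → G.HasMelon := by
    rintro L ⟨u, w, hL⟩ htL hLS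
    refine ih L.card ?_ L rfl ⟨_, hL.left_mem⟩ (.inr ⟨u, w, hL⟩)
    rw [← hn]
    exact Finset.card_lt_card ⟨hLS, fun h => htL (h ht)⟩
  -- The complement of `S` is connected and contains neither `t` nor `t'`, so it lies on one side of
  -- the curve; the other side is inside `S`.
  have hsub : M ⊆ S ∨ N ⊆ S := by
    rcases hS with rfl | ⟨p, q, hS⟩
    · exact .inl (Finset.subset_univ _)
    have hne : ∀ s, s ∉ S → s ≠ t ∧ s ≠ t' := fun s hs =>
      ⟨by rintro rfl; exact hs ht, by rintro rfl; exact hs ht'⟩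
    have key := hS.compl.eq_of_inner hG (g := fun s => if s ∈ M then 1 else 0) (fun x hx hx' => by
      rw [Finset.mem_compl] at hx hx'
      refine if_congr ⟨fun h => ?_, fun h => ?_⟩ rfl rfl
      · have := hcl _ h
        rw [G.contr_contr] at this
        have h2 := hne _ hx
        tauto
      · have := hcl _ h
        have h2 := hne _ hx'
        tauto)
    by_cases hp : (G.contr p).1 ∈ M
    · right
      intro s hsN
      by_contra hs
      have h1 := key s (by simpa using hs)
      simp only [hp, if_true] at h1
      have h2 := hne s hs
      have h3 : s ∈ M := by
        by_contra h; simp [h] at h1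
      exact (hMN s h2.1 h2.2).1 h3 hsN
    · left
      intro s hsM
      by_contra hs
      have h1 := key s (by simpa using hs)
      simp [hp, hsM] at h1
  rcases hsub with h | h
  · exact hdesc M ⟨u, w, hM⟩ htM h
  · exact hdesc N ⟨u', w', hN⟩ htN h

/-- A connected diagram with the largest possible number of index loops has a melon. -/
theorem IsConnected.hasMelon (hG : G.IsConnected) [Nonempty T]
    (hF : 3 * Fintype.card T + 6 ≤
      2 * ∑ c : Fin 3, finrank (ZMod 2) (G.loopFun c Finset.univ))
    (heven : Even (Fintype.card T)) : G.HasMelon :=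
  hG.hasMelon_of_isCut hF heven _ Finset.univ rfl Finset.univ_nonempty (.inl rfl)

end TetraDiagram

/-! ### Counting components of prism diagrams by dimensions -/

/-- The functions modulo two that are constant along a relation. -/
def relationFun {X : Type*} (r : X → X → Prop) : Submodule (ZMod 2) (X → ZMod 2) where
  carrier := {g | ∀ x y, r x y → g x = g y}
  add_mem' := fun hf hg x y h => by simp [hf x y h, hg x y h]
  zero_mem' := fun _ _ _ => rfl
  smul_mem' := fun a f hf x y h => by simp [hf x y h]

/-- The functions that are constant along a relation are the functions on the quotient. -/
def relationFunEquiv {X : Type*} (r : X → X → Prop) :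
    relationFun r ≃ₗ[ZMod 2] (Quot r → ZMod 2) where
  toFun g := Quot.lift g.1 g.2
  map_add' f g := by ext ⟨x⟩; rfl
  map_smul' a f := by ext ⟨x⟩; rfl
  invFun f := ⟨fun x => f (Quot.mk r x), fun _ _ h => congrArg f (Quot.sound h)⟩
  left_inv _ := rfl
  right_inv f := by ext ⟨x⟩; rfl

theorem finrank_relationFun {X : Type*} [Finite X] (r : X → X → Prop) :
    finrank (ZMod 2) (relationFun r) = Nat.card (Quot r) := by
  have := Fintype.ofFinite (Quot r)
  rw [(relationFunEquiv r).finrank_eq, finrank_fintype_fun_eq_card, Nat.card_eq_fintype_card]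

theorem prismPartner_prismPartner (c : PrismColour) (x : PrismField) :
    prismPartner c (prismPartner c x) = x := by
  revert c x; decide

theorem prismPartner_ne (c : PrismColour) (x : PrismField) : prismPartner c x ≠ x := by
  revert c x; decide

theorem eq_of_prismPartner {f : PrismField → ZMod 2}
    (h : ∀ c x, f (prismPartner c x) = f x) (x y : PrismField) : f x = f y := by
  have h0 : ∀ x : PrismField, ∃ c d : PrismColour, x = prismPartner c (prismPartner d (false, 0)) ∨
      x = prismPartner c (false, 0) ∨ x = (false, 0) := by decide
  have key : ∀ x, f x = f (false, 0) := by
    intro x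
    obtain ⟨c, d, hx | hx | hx⟩ := h0 x
    · rw [hx, h, h]
    · rw [hx, h]
    · rw [hx]
  rw [key x, key y]

namespace PrismDiagram

/-- The functions modulo two on the fields that are constant along propagators and along
the edges of the interaction vertices with colours in `C`. -/
def invFun (D : PrismDiagram) (C : Set PrismColour) : Submodule (ZMod 2) (D.HalfEdge → ZMod 2) where
  carrier := {g | (∀ x, g (D.contr x) = g x) ∧
    ∀ c ∈ C, ∀ v i, g (v, prismPartner c i) = g (v, i)}
  add_mem' := by
    rintro f g ⟨hf, hf'⟩ ⟨hg, hg'⟩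
    exact ⟨fun x => by simp [hf, hg], fun c hc v i => by simp [hf' c hc, hg' c hc]⟩
  zero_mem' := ⟨fun _ => rfl, fun _ _ _ _ => rfl⟩
  smul_mem' := by
    rintro a f ⟨hf, hf'⟩
    exact ⟨fun x => by simp [hf], fun c hc v i => by simp [hf' c hc]⟩

/-- The number of components of the graph formed by the propagators and the edges
with colours in `C`. -/
noncomputable def count (D : PrismDiagram) (C : Set PrismColour) : ℕ :=
  finrank (ZMod 2) (D.invFun C) + D.rings

theorem loops_eq_count (D : PrismDiagram) (c : PrismColour) : D.loops c = D.count {c} := by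
  rw [loops, count, ← finrank_relationFun]
  have : relationFun (D.Strand c) = D.invFun {c} := by
    ext g
    constructor
    · intro h
      refine ⟨fun x => (h _ _ (.inl rfl)).symm, ?_⟩
      rintro _ rfl v i
      exact (h (v, i) _ (.inr rfl)).symm
    · rintro ⟨h, h'⟩ x y (rfl | rfl)
      · exact (h x).symm
      · exact (h' c rfl x.1 x.2).symm
  rw [this]

theorem connected_iff_count (D : PrismDiagram) : D.Connected ↔ D.count Set.univ = 1 := by
  rw [Connected, count, ← finrank_relationFun]
  have key : ∀ g ∈ D.invFun Set.univ, ∀ v i j, g (v, i) = g (v, j) := fun g hg v =>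
    eq_of_prismPartner (f := fun i => g (v, i)) fun c x => hg.2 c trivial v x
  let e : relationFun D.Adj ≃ₗ[ZMod 2] D.invFun Set.univ :=
    { toFun := fun g => ⟨fun x => g.1 x.1, fun x => (g.2 _ _ ⟨x.2, (D.contr x).2, rfl⟩).symm,
        fun _ _ _ _ => rfl⟩
      map_add' := fun _ _ => rfl
      map_smul' := fun _ _ => rfl
      invFun := fun g => ⟨fun v => g.1 (v, (false, 0)), by
        rintro v w ⟨i, j, h⟩
        change g.1 (v, _) = g.1 (w, _)
        rw [key _ g.2 v _ i, key _ g.2 w _ j, ← h]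
        exact (g.2.1 _).symm⟩
      left_inv := fun _ => rfl
      right_inv := fun g => Subtype.ext (funext fun x => key _ g.2 x.1 _ x.2) }
  rw [e.finrank_eq]

namespace Iso

variable {D D' D'' : PrismDiagram}

theorem symm (h : Iso D D') : Iso D' D := by
  obtain ⟨hr, e, he, hp⟩ := h
  refine ⟨hr.symm, e.symm, fun x => ?_, fun c x => ?_⟩
  · rw [Equiv.symm_apply_eq, he, Equiv.apply_symm_apply]
  · rw [Equiv.symm_apply_eq, hp, Equiv.apply_symm_apply]

theorem trans (h : Iso D D') (h' : Iso D' D'') : Iso D D'' := by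
  obtain ⟨hr, e, he, hp⟩ := h
  obtain ⟨hr', e', he', hp'⟩ := h'
  exact ⟨hr.trans hr', e.trans e', fun x => by simp [he, he'], fun c x => by
    rw [Equiv.trans_apply, hp, hp']; rfl⟩

theorem count_eq (h : Iso D D') (C : Set PrismColour) : D.count C = D'.count C := by
  obtain ⟨hr, e, he, hp⟩ := h
  let φ : D.invFun C ≃ₗ[ZMod 2] D'.invFun C :=
    { toFun := fun g => ⟨fun x => g.1 (e.symm x), fun x => by
          have := he (e.symm x)
          rw [Equiv.apply_symm_apply] at this
          simp only [← this, Equiv.symm_apply_apply, g.2.1], fun c hc v i => by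
          have := hp c (e.symm (v, i))
          rw [Equiv.apply_symm_apply] at this
          change e _ = (v, prismPartner c i) at this
          simp only [← this, Equiv.symm_apply_apply, g.2.2 c hc]⟩
      map_add' := fun _ _ => rfl
      map_smul' := fun _ _ => rfl
      invFun := fun g => ⟨fun x => g.1 (e x), fun x => by simp only [he, g.2.1], fun c hc v i => by
          have := hp c (v, i)
          simp only at this
          simp only [this, g.2.2 c hc]⟩
      left_inv := fun g => Subtype.ext (funext fun x => by simp)
      right_inv := fun g => Subtype.ext (funext fun x => by simp) }
  rw [count, count, φ.finrank_eq, hr]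

theorem numVertices_eq (h : Iso D D') : D.numVertices = D'.numVertices := by
  obtain ⟨-, e, -⟩ := h
  have := Nat.card_congr e
  rw [Nat.card_prod D.V, Nat.card_prod D'.V] at this
  exact Nat.eq_of_mul_eq_mul_right (Nat.card_pos (α := PrismField)) this

theorem connected_iff (h : Iso D D') : D.Connected ↔ D'.Connected := by
  rw [connected_iff_count, connected_iff_count, h.count_eq]

theorem totalLoops_eq (h : Iso D D') : D.totalLoops = D'.totalLoops := by
  simp only [totalLoops, loops_eq_count, h.count_eq]

end Iso

/-! ### Effect of inserting two-point diagrams -/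

theorem numVertices_union (D E : PrismDiagram) :
    (D.union E).numVertices = D.numVertices + E.numVertices := Nat.card_sum

theorem count_union (D E : PrismDiagram) (C : Set PrismColour) :
    (D.union E).count C = D.count C + E.count C := by
  let φ : (D.union E).invFun C ≃ₗ[ZMod 2] D.invFun C × E.invFun C :=
    { toFun := fun g => (⟨fun x => g.1 (left E x), fun x => g.2.1 (left E x),
          fun c hc v i => g.2.2 c hc (Sum.inl v) i⟩,
        ⟨fun x => g.1 (right D x), fun x => g.2.1 (right D x),
          fun c hc v i => g.2.2 c hc (Sum.inr v) i⟩)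
      map_add' := fun _ _ => rfl
      map_smul' := fun _ _ => rfl
      invFun := fun p => ⟨fun x => Sum.elim (fun v => p.1.1 (v, x.2)) (fun w => p.2.1 (w, x.2)) x.1,
        by
          rintro ⟨v | w, i⟩
          · exact p.1.2.1 (v, i)
          · exact p.2.2.1 (w, i), by
          rintro c hc (v | w) i
          · exact p.1.2.2 c hc v i
          · exact p.2.2.2 c hc w i⟩
      left_inv := fun g => Subtype.ext (funext fun x => by
        obtain ⟨v | w, i⟩ := x <;> rfl)
      right_inv := fun _ => rfl }
  have h1 := φ.finrank_eq
  rw [finrank_prod] at h1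
  have h2 : (D.union E).rings = D.rings + E.rings := rfl
  rw [count, count, count, h1, h2]
  ring

theorem count_replaceRing (D E : PrismDiagram) (hD : 0 < D.rings) (C : Set PrismColour) :
    (D.replaceRing E).count C + 1 = D.count C + E.count C := by
  rw [← count_union]
  have h1 : (D.replaceRing E).rings = D.rings - 1 + E.rings := rfl
  have h2 : (D.union E).rings = D.rings + E.rings := rfl
  have h3 : finrank (ZMod 2) ((D.replaceRing E).invFun C) =
    finrank (ZMod 2) ((D.union E).invFun C) := rfl
  rw [count, count, h1, h2, h3]
  omega

theorem mem_invFun_rewire (D : PrismDiagram) (π : Equiv.Perm D.HalfEdge) (C : Set PrismColour)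
    (g : D.HalfEdge → ZMod 2) :
    g ∈ (D.rewire π).invFun C ↔ (∀ x, g (π (D.contr x)) = g (π x)) ∧
      ∀ c ∈ C, ∀ v i, g (v, prismPartner c i) = g (v, i) := by
  refine and_congr_left fun _ => ⟨fun h x => ?_, fun h x => ?_⟩
  · have := h (π x)
    change g (π (D.contr (π.symm (π x)))) = _ at this
    rwa [Equiv.symm_apply_apply] at this
  · exact (h (π.symm x)).trans (congrArg g (π.apply_symm_apply x))

/-- An index line that enters a part of a diagram through one of two propagators leaves it
through the other one. -/
theorem eq_contr_of_partner (D : PrismDiagram) {c : PrismColour} (h : D.HalfEdge)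
    {g : D.HalfEdge → ZMod 2} (hg : ∀ v i, g (v, prismPartner c i) = g (v, i))
    (hin : ∀ x, x ≠ h → x ≠ D.contr h → g (D.contr x) = g x) : g (D.contr h) = g h := by
  classical
  have := Fintype.ofFinite D.HalfEdge
  have h1 : ∑ x, g x = 0 := sum_eq_zero_of_involution _ (fun x => (x.1, prismPartner c x.2))
    (fun x => by simp [prismPartner_prismPartner])
    (fun x hx => prismPartner_ne c x.2 (congrArg Prod.snd hx)) (by simp) _ (fun x _ => hg x.1 x.2)
  have h2 : ∑ x ∈ (Finset.univ.erase h).erase (D.contr h), g x = 0 := by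
    refine sum_eq_zero_of_involution _ D.contr D.contr_contr D.contr_ne ?_ _ ?_
    · intro x hx
      simp only [Finset.mem_erase, Finset.mem_univ, and_true] at hx ⊢
      refine ⟨fun he => hx.2 ?_, fun he => hx.1 ?_⟩
      · rw [← D.contr_contr x, he, D.contr_contr]
      · rw [← he, D.contr_contr]
    · intro x hx
      simp only [Finset.mem_erase, Finset.mem_univ, and_true] at hx
      exact hin x hx.2 hx.1
  rw [← Finset.add_sum_erase _ _ (Finset.mem_univ h), ← Finset.add_sum_erase _ _
    (show D.contr h ∈ Finset.univ.erase h by simp [D.contr_ne]), h2, add_zero,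
    CharTwo.add_eq_zero] at h1
  exact h1.symm

/-- For any colour in `C`, parity forces equal values at the two ends of the cut propagator on each
side (`eq_contr_of_partner`), so the new diagram imposes the old conditions and one gluing
condition. The set `C` must be nonempty to supply that colour. -/
theorem mem_invFun_replaceEdge (D E : PrismDiagram) (h : D.HalfEdge) (a : E.HalfEdge)
    {C : Set PrismColour} (hC : C.Nonempty) (g : (D.union E).HalfEdge → ZMod 2) :
    g ∈ (D.replaceEdge E h a).invFun C ↔
      (fun x => g (left E x)) ∈ D.invFun C ∧ (fun x => g (right D x)) ∈ E.invFun C ∧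
        g (left E h) = g (right D a) := by
  classical
  have inj : Function.Injective (left (D := D) E) := by
    rintro ⟨v, i⟩ ⟨w, j⟩ h
    have h2 := congrArg Prod.snd h
    exact Prod.ext (Sum.inl_injective (congrArg Prod.fst h)) h2
  have inj' : Function.Injective (right D (E := E)) := by
    rintro ⟨v, i⟩ ⟨w, j⟩ h
    have h2 := congrArg Prod.snd h
    exact Prod.ext (Sum.inr_injective (congrArg Prod.fst h)) h2
  have hlr : ∀ x y, left E x ≠ right D y := by
    rintro ⟨v, i⟩ ⟨w, j⟩ h
    exact Sum.inl_ne_inr (congrArg Prod.fst h)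
  have cl : ∀ x, (D.union E).contr (left E x) = left E (D.contr x) := fun _ => rfl
  have cr : ∀ x, (D.union E).contr (right D x) = right D (E.contr x) := fun _ => rfl
  refine (mem_invFun_rewire (D.union E) (Equiv.swap (left E (D.contr h)) (right D a)) C g).trans ?_
  set π := Equiv.swap (left E (D.contr h)) (right D a) with hπ
  have p1 : π (left E (D.contr h)) = right D a := Equiv.swap_apply_left _ _
  have p2 : π (right D a) = left E (D.contr h) := Equiv.swap_apply_right _ _
  have p3 : ∀ x, x ≠ D.contr h → π (left E x) = left E x := fun x hx =>
    Equiv.swap_apply_of_ne_of_ne (fun he => hx (inj he)) (hlr _ _)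
  have p4 : ∀ x, x ≠ a → π (right D x) = right D x := fun x hx =>
    Equiv.swap_apply_of_ne_of_ne (hlr _ _).symm (fun he => hx (inj' he))
  have hh : h ≠ D.contr h := (D.contr_ne h).symm
  have ha : E.contr a ≠ a := E.contr_ne a
  constructor
  · rintro ⟨hg, hp⟩
    obtain ⟨c, hc⟩ := hC
    have e1 : g (left E h) = g (right D a) := by
      have := hg (left E h)
      rwa [cl, p1, p3 h hh, eq_comm] at this
    have e2 : g (right D (E.contr a)) = g (left E (D.contr h)) := by
      have := hg (right D a)
      rwa [cr, p2, p4 _ ha] at this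
    have e3 : ∀ x, x ≠ h → x ≠ D.contr h → g (left E (D.contr x)) = g (left E x) := by
      intro x hx hx'
      have := hg (left E x)
      rwa [cl, p3 x hx', p3 (D.contr x)] at this
      intro he; exact hx (by rw [← D.contr_contr x, he, D.contr_contr])
    have e4 : ∀ x, x ≠ a → x ≠ E.contr a → g (right D (E.contr x)) = g (right D x) := by
      intro x hx hx'
      have := hg (right D x)
      rwa [cr, p4 x hx, p4 (E.contr x)] at this
      intro he; exact hx' (by rw [← he, E.contr_contr])
    have f1 := D.eq_contr_of_partner h (g := fun x => g (left E x))
      (fun v i => hp c hc (Sum.inl v) i) e3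
    have f2 := E.eq_contr_of_partner a (g := fun x => g (right D x))
      (fun v i => hp c hc (Sum.inr v) i) e4
    refine ⟨⟨fun x => ?_, fun d hd v i => hp d hd (Sum.inl v) i⟩,
      ⟨fun x => ?_, fun d hd v i => hp d hd (Sum.inr v) i⟩, e1⟩
    · by_cases hx : x = h
      · rw [hx]; exact f1
      by_cases hx' : x = D.contr h
      · rw [hx', D.contr_contr]; exact f1.symm
      exact e3 x hx hx'
    · by_cases hx : x = a
      · rw [hx]; exact f2
      by_cases hx' : x = E.contr a
      · rw [hx', E.contr_contr]; exact f2.symm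
      exact e4 x hx hx'
  · rintro ⟨⟨hα, hp⟩, ⟨hα', hp'⟩, he⟩
    have key : ∀ x, g (π x) = g x := by
      rintro ⟨v | w, i⟩
      · change g (π (left E (v, i))) = g (left E (v, i))
        by_cases hx : (v, i) = D.contr h
        · rw [hx, p1, ← he]; exact (hα h).symm
        · rw [p3 _ hx]
      · change g (π (right D (w, i))) = g (right D (w, i))
        by_cases hx : (w, i) = a
        · rw [hx, p2, ← he]; exact hα h
        · rw [p4 _ hx]
    refine ⟨fun x => ?_, ?_⟩
    · rw [key, key]
      obtain ⟨v | w, i⟩ := x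
      · exact hα (v, i)
      · exact hα' (w, i)
    · rintro c hc (v | w) i
      · exact hp c hc v i
      · exact hp' c hc w i

/-- The gluing condition is one nonzero linear equation: one component of `D` merges with one of
`E`. It covers both loops and connected components. -/
theorem count_replaceEdge (D E : PrismDiagram) (h : D.HalfEdge) (a : E.HalfEdge)
    {C : Set PrismColour} (hC : C.Nonempty) :
    (D.replaceEdge E h a).count C + 1 = D.count C + E.count C := by
  let ψ : D.invFun C × E.invFun C →ₗ[ZMod 2] ZMod 2 :=
    { toFun := fun p => p.1.1 h - p.2.1 a
      map_add' := fun p q => by simp; ring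
      map_smul' := fun a p => by simp; ring }
  let φ : (D.replaceEdge E h a).invFun C ≃ₗ[ZMod 2] LinearMap.ker ψ :=
    { toFun := fun g => ⟨(⟨fun x => g.1 (left E x), ((mem_invFun_replaceEdge D E h a hC g.1).1 g.2).1⟩,
        ⟨fun x => g.1 (right D x), ((mem_invFun_replaceEdge D E h a hC g.1).1 g.2).2.1⟩),
        sub_eq_zero.2 ((mem_invFun_replaceEdge D E h a hC g.1).1 g.2).2.2⟩
      map_add' := fun _ _ => rfl
      map_smul' := fun _ _ => rfl
      invFun := fun p => ⟨fun x => Sum.elim (fun v => p.1.1.1 (v, x.2))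
          (fun w => p.1.2.1 (w, x.2)) x.1,
        (mem_invFun_replaceEdge D E h a hC _).2 ⟨p.1.1.2, p.1.2.2, sub_eq_zero.1 p.2⟩⟩
      left_inv := fun g => Subtype.ext (funext fun x => by
        obtain ⟨v | w, i⟩ := x <;> rfl)
      right_inv := fun _ => rfl }
  have h1 := φ.finrank_eq
  have h2 := LinearMap.finrank_range_add_finrank_ker ψ
  have h3 : LinearMap.range ψ = ⊤ := by
    refine LinearMap.range_eq_top.2 fun t => ⟨(⟨fun _ => t, fun _ => rfl, fun _ _ _ _ => rfl⟩, 0), ?_⟩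
    simp [ψ]
  rw [h3, finrank_top, finrank_self, finrank_prod] at h2
  have h4 : (D.replaceEdge E h a).rings = D.rings + E.rings := rfl
  rw [count, count, count, h4]
  omega

end PrismDiagram

theorem prismPartner_rung (c : PrismColour) (s : Bool) : prismPartner c (s, c) = (!s, c) :=
  if_pos rfl

theorem prismPartner_of_ne {c d : PrismColour} (h : d ≠ c) (s : Bool) :
    prismPartner c (s, d) = (s, -(d + c)) :=
  if_neg h

theorem neg_add_ne {c d : PrismColour} (h : d ≠ c) : -(d + c) ≠ c := by
  revert c d; decide

namespace PrismDiagram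

/-! ### Effect of vertex expansion -/

section Expand

variable (D : PrismDiagram) (v : D.V)

theorem exchange_left_of_ne {w : D.V} (h : w ≠ v) (i : PrismField) :
    D.exchange v (Sum.inl w, i) = (Sum.inl w, i) := by
  obtain ⟨_ | _, c⟩ := i <;> simp [exchange, h]

theorem exchange_left_true (w : D.V) (c : PrismColour) :
    D.exchange v (Sum.inl w, (true, c)) = (Sum.inl w, (true, c)) := rfl

theorem exchange_left_false (c : PrismColour) :
    D.exchange v (Sum.inl v, (false, c)) = (Sum.inr (), (true, c)) := by
  simp [exchange]

theorem exchange_right_false (c : PrismColour) :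
    D.exchange v (Sum.inr (), (false, c)) = (Sum.inr (), (false, c)) := rfl

theorem exchange_right_true (c : PrismColour) :
    D.exchange v (Sum.inr (), (true, c)) = (Sum.inl v, (false, c)) := rfl

/-- After undoing the exchange of ends, the old propagators obey the old conditions. What is new are
the values on the three propagators between the triangles: the rungs of `R` tie them to the old
fields, and the triangle edges tie them to each other. -/
theorem mem_invFun_expand (C : Set PrismColour) (g : (D.V ⊕ Unit) × PrismField → ZMod 2) :
    g ∈ (D.expand v).invFun C ↔
      (fun x : D.HalfEdge => g (D.exchange v (Sum.inl x.1, x.2))) ∈ D.invFun C ∧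
      (∀ c, g (Sum.inl v, (false, c)) = g (Sum.inr (), (false, c))) ∧
      ∀ c ∈ C, g (Sum.inr (), (true, c)) = g (Sum.inr (), (false, c)) ∧
        ∀ d, d ≠ c → g (Sum.inr (), (false, -(d + c))) = g (Sum.inr (), (false, d)) := by
  refine (mem_invFun_rewire (D.union closedSnail) (D.exchange_involutive v).toPerm C g).trans ?_
  change (_ ∧ ∀ c ∈ C, ∀ (w : D.V ⊕ Unit) (i : PrismField),
    g (w, prismPartner c i) = g (w, i)) ↔ _
  constructor
  · rintro ⟨hα, hp⟩
    have h1 : ∀ c, g (Sum.inl v, (false, c)) = g (Sum.inr (), (false, c)) := fun c =>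
      hα (Sum.inr (), (false, c))
    have h2 : ∀ c ∈ C, g (Sum.inr (), (true, c)) = g (Sum.inr (), (false, c)) := fun c hc => by
      have := hp c hc (Sum.inr ()) (false, c)
      rwa [prismPartner_rung] at this
    have h3 : ∀ c ∈ C, g (Sum.inl v, (true, c)) = g (Sum.inl v, (false, c)) := fun c hc => by
      have := hp c hc (Sum.inl v) (false, c)
      rwa [prismPartner_rung] at this
    refine ⟨⟨fun x => hα (Sum.inl x.1, x.2), fun c hc w i => ?_⟩, h1, fun c hc => ⟨h2 c hc,
      fun d hd => ?_⟩⟩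
    · by_cases hw : w = v
      · subst hw
        obtain ⟨s, d⟩ := i
        by_cases hd : d = c
        · subst hd
          rw [prismPartner_rung]
          cases s
          · simp only [Bool.not_false, exchange_left_true, exchange_left_false]
            rw [h3 d hc, h2 d hc, h1]
          · simp only [Bool.not_true, exchange_left_true, exchange_left_false]
            rw [h3 d hc, h2 d hc, h1]
        · rw [prismPartner_of_ne hd]
          cases s
          · simp only [exchange_left_false]
            have := hp c hc (Sum.inr ()) (true, d)
            rwa [prismPartner_of_ne hd] at this
          · simp only [exchange_left_true]
            have := hp c hc (Sum.inl w) (true, d)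
            rwa [prismPartner_of_ne hd] at this
      · simp only [D.exchange_left_of_ne v hw]
        exact hp c hc (Sum.inl w) i
    · have := hp c hc (Sum.inr ()) (false, d)
      rwa [prismPartner_of_ne hd] at this
  · rintro ⟨⟨hα, hp⟩, h1, h2⟩
    have h3 : ∀ c ∈ C, g (Sum.inr (), (true, c)) = g (Sum.inl v, (true, c)) := fun c hc => by
      have := hp c hc v (true, c)
      simpa only [prismPartner_rung, Bool.not_true, exchange_left_true,
        exchange_left_false] using this
    refine ⟨?_, fun c hc w i => ?_⟩
    · rintro ⟨w | _, s, c⟩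
      · exact hα (w, (s, c))
      · cases s
        · exact h1 c
        · exact (h1 c).symm
    · obtain ⟨s, d⟩ := i
      rcases w with w | _
      · by_cases hw : w = v
        · subst hw
          by_cases hd : d = c
          · subst hd
            rw [prismPartner_rung]
            cases s
            · rw [Bool.not_false, ← h3 d hc, (h2 d hc).1, h1]
            · rw [Bool.not_true, ← h3 d hc, (h2 d hc).1, h1]
          · rw [prismPartner_of_ne hd]
            cases s
            · rw [h1, h1, (h2 c hc).2 d hd]
            · have := hp c hc w (true, d)
              simpa only [prismPartner_of_ne hd, exchange_left_true] using this
        · have := hp c hc w (s, d)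
          simpa only [D.exchange_left_of_ne v hw] using this
      · by_cases hd : d = c
        · subst hd
          rw [prismPartner_rung]
          cases s
          · exact (h2 d hc).1
          · exact (h2 d hc).1.symm
        · rw [prismPartner_of_ne hd]
          cases s
          · exact (h2 c hc).2 d hd
          · have := hp c hc v (false, d)
            simpa only [prismPartner_of_ne hd, exchange_left_false] using this

/-- A function on the fields of an expanded diagram, from its values on the propagators of the
old diagram and those on the three new propagators. -/
noncomputable def expandFun (f : D.HalfEdge → ZMod 2) (r : PrismColour → ZMod 2) :
    (D.V ⊕ Unit) × PrismField → ZMod 2 :=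
  fun x => Sum.elim (fun w => f (w, (D.exchange v x).2)) (fun _ => r (D.exchange v x).2.2)
    (D.exchange v x).1

theorem expandFun_exchange (f : D.HalfEdge → ZMod 2) (r : PrismColour → ZMod 2) (x : D.HalfEdge) :
    D.expandFun v f r (D.exchange v (Sum.inl x.1, x.2)) = f x := by
  rw [expandFun, D.exchange_involutive]
  rfl

theorem expandFun_mem {C : Set PrismColour} {f : D.HalfEdge → ZMod 2} (hf : f ∈ D.invFun C)
    {r : PrismColour → ZMod 2}
    (hr : ∀ c ∈ C, f (v, (false, c)) = r c ∧ ∀ d, d ≠ c → r (-(d + c)) = r d) :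
    D.expandFun v f r ∈ (D.expand v).invFun C := by
  refine (D.mem_invFun_expand v C _).2 ⟨?_, fun c => ?_, fun c hc => ⟨?_, fun d hd => ?_⟩⟩
  · simpa only [expandFun_exchange] using hf
  · rw [expandFun, expandFun, exchange_left_false, exchange_right_false]
    rfl
  · rw [expandFun, expandFun, exchange_right_true, exchange_right_false]
    exact (hr c hc).1
  · exact (hr c hc).2 d hd

theorem expandFun_restrict {C : Set PrismColour} {g : (D.V ⊕ Unit) × PrismField → ZMod 2}
    (hg : g ∈ (D.expand v).invFun C) :
    D.expandFun v (fun x => g (D.exchange v (Sum.inl x.1, x.2)))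
      (fun c => g (Sum.inr (), (false, c))) = g := by
  obtain ⟨-, h1, -⟩ := (D.mem_invFun_expand v C _).1 hg
  have key : ∀ x, D.expandFun v (fun x => g (D.exchange v (Sum.inl x.1, x.2)))
      (fun c => g (Sum.inr (), (false, c))) (D.exchange v x) = g (D.exchange v x) := by
    rintro ⟨w | _, s, c⟩
    · exact D.expandFun_exchange v _ _ (w, (s, c))
    · rw [expandFun, D.exchange_involutive]
      cases s
      · rfl
      · exact (h1 c).symm
  ext x
  rw [← D.exchange_involutive v x]
  exact key _

theorem count_expand_univ : (D.expand v).count Set.univ = D.count Set.univ := by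
  let φ : (D.expand v).invFun Set.univ ≃ₗ[ZMod 2] D.invFun Set.univ :=
    { toFun := fun g => ⟨_, ((D.mem_invFun_expand v _ g.1).1 g.2).1⟩
      map_add' := fun _ _ => rfl
      map_smul' := fun _ _ => rfl
      invFun := fun f => ⟨D.expandFun v f.1 (fun _ => f.1 (v, (false, 0))),
        D.expandFun_mem v f.2 fun c _ => ⟨eq_of_prismPartner (f := fun i => f.1 (v, i))
          (fun c x => f.2.2 c trivial v x) _ _, fun _ _ => rfl⟩⟩
      left_inv := fun g => Subtype.ext (by
        obtain ⟨-, -, h2⟩ := (D.mem_invFun_expand v _ g.1).1 g.2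
        refine Eq.trans ?_ (D.expandFun_restrict v g.2)
        simp only
        congr 1
        ext c
        rw [exchange_left_false, (h2 0 trivial).1]
        by_cases hc : c = 0
        · rw [hc]
        · have h3 := (h2 (-c) trivial).2 c (by clear h2; revert c; decide)
          simpa using h3)
      right_inv := fun f => Subtype.ext (funext fun x =>
        D.expandFun_exchange v f.1 (fun _ => f.1 (v, (false, 0))) x) }
  have h1 : (D.expand v).rings = D.rings := rfl
  rw [count, count, φ.finrank_eq, h1]

theorem count_expand_singleton (c : PrismColour) :
    (D.expand v).count {c} = D.count {c} + 1 := by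
  let φ : (D.expand v).invFun {c} ≃ₗ[ZMod 2] D.invFun {c} × ZMod 2 :=
    { toFun := fun g => (⟨_, ((D.mem_invFun_expand v _ g.1).1 g.2).1⟩,
        -- Of the three new propagators, the one at corner `c` continues old loops of colour `c`.
        -- The other two close up into one new loop, read off here at corner `c + 1`.
        g.1 (Sum.inr (), (false, c + 1)))
      map_add' := fun _ _ => rfl
      map_smul' := fun _ _ => rfl
      invFun := fun p => ⟨D.expandFun v p.1.1
          (fun d => if d = c then p.1.1 (v, (false, c)) else p.2),
        D.expandFun_mem v p.1.2 (by
          rintro _ rfl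
          refine ⟨(if_pos rfl).symm, fun d hd => ?_⟩
          rw [if_neg hd, if_neg (neg_add_ne hd)])⟩
      left_inv := fun g => Subtype.ext (by
        obtain ⟨-, -, h2⟩ := (D.mem_invFun_expand v _ g.1).1 g.2
        refine Eq.trans ?_ (D.expandFun_restrict v g.2)
        simp only
        congr 1
        ext d
        rw [exchange_left_false, (h2 c rfl).1]
        split_ifs with hd
        · rw [hd]
        · by_cases hd' : d = c + 1
          · subst hd'; rfl
          · have h3 := (h2 c rfl).2 (c + 1) (by simp)
            have h4 : -(c + 1 + c) = d := by
              clear * - hd hd'; revert c d; decide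
            exact h3.symm.trans (congrArg (fun e => g.1 (Sum.inr (), (false, e))) h4))
      right_inv := fun p => by
        refine Prod.ext (Subtype.ext (funext fun x =>
          D.expandFun_exchange v p.1.1
            (fun d => if d = c then p.1.1 (v, (false, c)) else p.2) x)) ?_
        change (if c + 1 = c then p.1.1 (v, (false, c)) else p.2) = p.2
        simp }
  have h1 : (D.expand v).rings = D.rings := rfl
  have h2 := φ.finrank_eq
  rw [finrank_prod, finrank_self] at h2
  rw [count, count, h2, h1]
  ring

theorem connected_expand : (D.expand v).Connected ↔ D.Connected := by
  rw [connected_iff_count, connected_iff_count, count_expand_univ]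

theorem totalLoops_expand : (D.expand v).totalLoops = D.totalLoops + 3 := by
  simp only [totalLoops, loops_eq_count, count_expand_singleton, Fin.sum_univ_three]
  ring

theorem numVertices_expand : (D.expand v).numVertices = D.numVertices + 1 := by
  change Nat.card (D.V ⊕ Unit) = Nat.card D.V + 1
  rw [Nat.card_sum, Nat.card_unique (α := Unit)]

end Expand

/-! ### From prisms to tetrahedra -/

section Tetra

variable (D : PrismDiagram)

/-- Split each prism vertex into two tetrahedra, joined by a propagator of the auxiliary field. -/
def toTetra : TetraDiagram (D.V × Bool) where
  contr x := match x with
    | (t, none) => ((t.1, !t.2), none)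
    | (t, some c) => (((D.contr (t.1, (t.2, c))).1, (D.contr (t.1, (t.2, c))).2.1),
        some (D.contr (t.1, (t.2, c))).2.2)
  contr_contr := by
    rintro ⟨⟨v, s⟩, _ | c⟩
    · simp
    · simp [D.contr_contr]
  contr_ne := by
    rintro ⟨⟨v, s⟩, _ | c⟩ h
    · simp at h
    · simp only [Prod.mk.injEq, Option.some.injEq] at h
      exact D.contr_ne (v, (s, c)) (Prod.ext h.1.1 (Prod.ext h.1.2 h.2))

theorem toTetra_contr_none (v : D.V) (s : Bool) :
    D.toTetra.contr ((v, s), none) = ((v, !s), none) := rfl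

theorem toTetra_contr_some (v : D.V) (s : Bool) (c : PrismColour) :
    D.toTetra.contr ((v, s), some c) = (((D.contr (v, (s, c))).1, (D.contr (v, (s, c))).2.1),
        some (D.contr (v, (s, c))).2.2) := rfl

theorem tetraPartner_some_of_ne {c d : Fin 3} (h : d ≠ c) :
    tetraPartner c (some d) = some (-(d + c)) := if_neg h

theorem tetraPartner_some_self (c : Fin 3) : tetraPartner c (some c) = none := if_pos rfl

variable [Fintype D.V] [DecidableEq D.V]

theorem finrank_loopFun_toTetra (c : PrismColour) :
    finrank (ZMod 2) (D.toTetra.loopFun c Finset.univ) = finrank (ZMod 2) (D.invFun {c}) := by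
  let φ : D.toTetra.loopFun c Finset.univ ≃ₗ[ZMod 2] D.invFun {c} :=
    { toFun := fun h => ⟨fun x => h.1 ((x.1, x.2.1), some x.2.2),
        fun x => h.2.1.1 ((x.1, x.2.1), some x.2.2), by
          rintro e he v ⟨s, d⟩
          obtain rfl : c = e := he.symm
          by_cases hd : d = c
          · subst hd
            rw [prismPartner_rung]
            have h1 := fun s => h.2.2 (v, s) none
            have h2 := h.2.1.1 ((v, s), none)
            rw [toTetra_contr_none] at h2
            exact (h1 (!s)).trans (h2.trans (h1 s).symm)
          · rw [prismPartner_of_ne hd]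
            have h1 := h.2.2 (v, s) (some d)
            rwa [tetraPartner_some_of_ne hd] at h1⟩
      map_add' := fun _ _ => rfl
      map_smul' := fun _ _ => rfl
      -- The auxiliary field is joined to corner `c` by the edge of colour `c`, so it takes the
      -- value there; hence the default `c`.
      invFun := fun g => ⟨fun x => g.1 (x.1.1, (x.1.2, x.2.getD c)), ⟨by
          rintro ⟨⟨v, s⟩, _ | d⟩
          · have := g.2.2 c rfl v (s, c)
            rwa [prismPartner_rung] at this
          · exact g.2.1 (v, (s, d)), fun x hx => absurd (Finset.mem_univ _) hx⟩, by
          rintro ⟨v, s⟩ (_ | d)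
          · rfl
          · by_cases hd : d = c
            · subst hd
              rw [tetraPartner_some_self]
              rfl
            · rw [tetraPartner_some_of_ne hd]
              have := g.2.2 c rfl v (s, d)
              rwa [prismPartner_of_ne hd] at this⟩
      left_inv := fun h => Subtype.ext (funext fun x => by
        obtain ⟨t, _ | d⟩ := x
        · exact h.2.2 t none
        · rfl)
      right_inv := fun _ => rfl }
  exact φ.finrank_eq

theorem rings_eq_zero (hD : D.Connected) [Nonempty D.V] :
    D.rings = 0 ∧ finrank (ZMod 2) (D.invFun Set.univ) = 1 := by
  rw [connected_iff_count, count] at hD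
  have h1 : 0 < finrank (ZMod 2) (D.invFun Set.univ) := by
    have : Nontrivial (D.invFun Set.univ) := by
      obtain ⟨v⟩ := ‹Nonempty D.V›
      refine ⟨⟨⟨fun _ => 1, fun _ => rfl, fun _ _ _ _ => rfl⟩, 0, fun h => ?_⟩⟩
      have := congrFun (congrArg Subtype.val h) (v, (false, 0))
      exact one_ne_zero this
    exact finrank_pos
  omega

theorem isConnected_toTetra (hD : D.Connected) [Nonempty D.V] : D.toTetra.IsConnected := by
  intro g hg
  have h1 : ∀ v s, g (v, s) = g (v, false) := by
    rintro v (_ | _)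
    · rfl
    · exact hg ((v, false), none)
  let one : D.invFun Set.univ := ⟨fun _ => 1, fun _ => rfl, fun _ _ _ _ => rfl⟩
  have hone : one ≠ 0 := by
    obtain ⟨v⟩ := ‹Nonempty D.V›
    exact fun h => one_ne_zero (congrFun (congrArg Subtype.val h) (v, (false, 0)))
  obtain ⟨a, ha⟩ := (finrank_eq_one_iff_of_nonzero' one hone).1 (D.rings_eq_zero hD).2
    ⟨fun x => g (x.1, false), fun x => by
      have := hg ((x.1, x.2.1), some x.2.2)
      rw [toTetra_contr_some] at this
      simp only [h1] at this
      exact this, fun _ _ _ _ => rfl⟩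
  have key : ∀ v, g (v, false) = a := by
    intro v
    have := congrFun (congrArg Subtype.val ha) (v, (false, 0))
    simpa [one] using this.symm
  rintro ⟨v, s⟩ ⟨w, s'⟩
  rw [h1, h1 w, key, key]

theorem sum_finrank_toTetra (hD : D.Connected) [Nonempty D.V] :
    ∑ c : Fin 3, finrank (ZMod 2) (D.toTetra.loopFun c Finset.univ) = D.totalLoops := by
  simp only [totalLoops, loops_eq_count, count, (D.rings_eq_zero hD).1, add_zero,
    finrank_loopFun_toTetra]

end Tetra

/-- The number of index loops of a connected diagram is at most `3 + 3 v`. -/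
theorem totalLoops_le {D : PrismDiagram} (hD : D.Connected) :
    D.totalLoops ≤ 3 + 3 * D.numVertices := by
  classical
  rcases isEmpty_or_nonempty D.V with hV | hV
  · have h1 : ∀ C, finrank (ZMod 2) (D.invFun C) = 0 := fun C => by
      have : Subsingleton (D.HalfEdge → ZMod 2) :=
        ⟨fun f g => funext fun x => hV.elim x.1⟩
      exact finrank_zero_of_subsingleton
    rw [connected_iff_count, count, h1] at hD
    simp only [totalLoops, loops_eq_count, count, h1, Fin.sum_univ_three]
    omega
  · have := Fintype.ofFinite D.V
    have hG := D.isConnected_toTetra hD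
    have h01 := hG.finrank_loopFun_add_le (show (0 : Fin 3) ≠ 1 by decide)
    have h02 := hG.finrank_loopFun_add_le (show (0 : Fin 3) ≠ 2 by decide)
    have h12 := hG.finrank_loopFun_add_le (show (1 : Fin 3) ≠ 2 by decide)
    have h := D.sum_finrank_toTetra hD
    rw [Fin.sum_univ_three] at h
    rw [Fintype.card_prod, Fintype.card_bool] at h01 h02 h12
    rw [numVertices, Nat.card_eq_fintype_card]
    omega

/-- A connected diagram with vertices and with the largest number of index loops has a prism
vertex with two rungs contracted, or two prism vertices with contracted triangles. -/
theorem exists_snail_or_expansion {D : PrismDiagram} (hD : D.Connected) [Nonempty D.V]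
    (hF : 3 + 3 * D.numVertices ≤ D.totalLoops) :
    (∃ (v : D.V) (s : Bool) (d : PrismColour), ∀ c, c ≠ d →
      D.contr (v, (s, c)) = (v, (!s, c))) ∨
    ∃ (v w : D.V) (s s' : Bool), v ≠ w ∧ ∀ c, D.contr (v, (s, c)) = (w, (s', c)) := by
  classical
  have := Fintype.ofFinite D.V
  have hG := D.isConnected_toTetra hD
  obtain ⟨⟨v, s⟩, ⟨w, s'⟩, k, k', m, hne, hk, hm⟩ := hG.hasMelon (by
    rw [D.sum_finrank_toTetra hD, Fintype.card_prod, Fintype.card_bool]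
    rw [numVertices, Nat.card_eq_fintype_card] at hF
    omega) (by rw [Fintype.card_prod, Fintype.card_bool]; exact even_iff_two_dvd.2 ⟨_, mul_comm _ _⟩)
  have hnone : ∀ l l', D.toTetra.contr ((v, s), l) = ((w, s'), l') → (l = none ↔ l' = none) := by
    rintro (_ | c) l' h
    · rw [toTetra_contr_none] at h
      have := congrArg Prod.snd h
      simp only at this
      simp [← this]
    · rw [toTetra_contr_some] at h
      have := congrArg Prod.snd h
      simp only at this
      simp [← this]
  -- The corresponding fields of the melon must be auxiliary simultaneously. As three of the four
  -- correspond, this fixes the correspondence of all fields.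
  have hkk : k = k' := by
    have h1 := hnone _ _ hk
    have h2 := fun c hc => hnone _ _ (hm c hc)
    clear * - h1 h2
    revert k k' m; decide
  subst hkk
  have hall : ∀ l, l ≠ tetraPartner m k → D.toTetra.contr ((v, s), l) = ((w, s'), l) := by
    intro l hl
    have : l = k ∨ ∃ c, c ≠ m ∧ l = tetraPartner c k := by
      clear * - hl; revert k l m; decide
    rcases this with rfl | ⟨c, hc, rfl⟩
    · exact hk
    · exact hm c hc
  have hsome : ∀ c, some c ≠ tetraPartner m k → D.contr (v, (s, c)) = (w, (s', c)) := by
    intro c hc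
    have := hall _ hc
    rw [toTetra_contr_some] at this
    simp only [Prod.mk.injEq, Option.some.injEq] at this
    exact Prod.ext this.1.1 (Prod.ext this.1.2 this.2)
  -- The case depends on the field left out of the melon. If it is auxiliary, whole triangles are
  -- contracted; if it is the corner `d`, the auxiliary propagator belongs to the melon, so both
  -- tetrahedra come from one prism with its other two rungs contracted.
  rcases hn : tetraPartner m k with _ | d
  · rw [hn] at hsome
    by_cases hvw : v = w
    · subst hvw
      have hs : s' = !s := by
        cases s <;> cases s' <;> simp_all
      subst hs
      exact .inl ⟨v, s, 0, fun c _ => hsome c (by simp)⟩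
    · exact .inr ⟨v, w, s, s', hvw, fun c => hsome c (by simp)⟩
  · have h1 := hall none (by rw [hn]; simp)
    rw [toTetra_contr_none] at h1
    simp only [Prod.mk.injEq, and_true] at h1
    obtain ⟨rfl, rfl⟩ := h1
    exact .inl ⟨v, s, d, fun c hc => hsome c (by rw [hn]; simpa using hc)⟩

end PrismDiagram

/-! ### Undoing snails and expansions -/

namespace PrismDiagram

theorem iso_rewire {D D' : PrismDiagram} (hr : D.rings = D'.rings) (e : D.HalfEdge ≃ D'.HalfEdge)
    (he : ∀ x, e (D.contr x) = D'.contr (e x))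
    (hp : ∀ (c : PrismColour) (x : D.HalfEdge),
      e (x.1, prismPartner c x.2) = ((e x).1, prismPartner c (e x).2))
    (π : Equiv.Perm D.HalfEdge) (π' : Equiv.Perm D'.HalfEdge) (hπ : ∀ x, e (π x) = π' (e x)) :
    Iso (D.rewire π) (D'.rewire π') := by
  refine ⟨hr, e, fun (x : D.HalfEdge) => ?_, hp⟩
  have h1 : e (π.symm x) = π'.symm (e x) := by
    rw [Equiv.eq_symm_apply, ← hπ, Equiv.apply_symm_apply]
  change e (π (D.contr (π.symm x))) = π' (D'.contr (π'.symm (e x)))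
  rw [hπ, he, h1]

theorem iso_rewire_self (D : PrismDiagram) (π : Equiv.Perm D.HalfEdge)
    (hp : ∀ (c : PrismColour) (x : D.HalfEdge),
      π (x.1, prismPartner c x.2) = ((π x).1, prismPartner c (π x).2)) :
    Iso D (D.rewire π) := by
  refine ⟨rfl, π, fun x => ?_, hp⟩
  change π (D.contr x) = π (D.contr (π.symm (π x)))
  rw [Equiv.symm_apply_apply]

theorem rewire_rewire_iso (D : PrismDiagram) (π : Equiv.Perm D.HalfEdge)
    (hπ : ∀ x, π (π x) = x) : Iso ((D.rewire π).rewire π) D := by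
  refine ⟨rfl, Equiv.refl _, fun (x : D.HalfEdge) => ?_, fun _ _ => rfl⟩
  have h1 : ∀ x, π.symm x = π x := fun x => by rw [Equiv.symm_apply_eq, hπ]
  change π (π (D.contr (π.symm (π.symm x)))) = D.contr x
  rw [hπ, h1, h1, hπ]

/-- Remove a vertex with its two triangles contracted with each other. -/
def remove (D : PrismDiagram) (v : D.V) (hv : ∀ s c, D.contr (v, (s, c)) = (v, (!s, c))) :
    PrismDiagram where
  V := {w : D.V // w ≠ v}
  finite := inferInstance
  contr x := (⟨(D.contr (x.1.1, x.2)).1, fun h => x.1.2 (by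
    have h1 := D.contr_contr (x.1.1, x.2)
    rw [← Prod.mk.eta (p := D.contr (x.1.1, x.2)), h, ← Prod.mk.eta (p := (D.contr (x.1.1, x.2)).2),
      hv] at h1
    exact (congrArg Prod.fst h1).symm)⟩, (D.contr (x.1.1, x.2)).2)
  contr_contr x := by simp [D.contr_contr]
  contr_ne x h := D.contr_ne (x.1.1, x.2)
    (Prod.ext (congrArg (fun y : {w : D.V // w ≠ v} × PrismField => y.1.1) h)
      (congrArg (fun y : {w : D.V // w ≠ v} × PrismField => y.2) h))
  rings := D.rings

open Classical in
/-- The fields of a diagram are those of one vertex and those of the others. -/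
noncomputable def removeEquiv (D : PrismDiagram) (v : D.V) :
    ({w : D.V // w ≠ v} ⊕ Unit) × PrismField ≃ D.HalfEdge :=
  Equiv.prodCongr
    { toFun := Sum.elim Subtype.val fun _ => v
      invFun := fun w => if h : w = v then Sum.inr () else Sum.inl ⟨w, h⟩
      left_inv := by
        rintro (⟨w, hw⟩ | _)
        · simp [hw]
        · simp
      right_inv := fun w => by
        by_cases h : w = v <;> simp [h] } (Equiv.refl _)

section Remove

variable {D : PrismDiagram} {v : D.V}

theorem removeEquiv_contr (hv : ∀ s c, D.contr (v, (s, c)) = (v, (!s, c)))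
    (x : ((D.remove v hv).union closedSnail).HalfEdge) :
    D.removeEquiv v (((D.remove v hv).union closedSnail).contr x) =
      D.contr (D.removeEquiv v x) := by
  obtain ⟨w | _, s, c⟩ := x
  · rfl
  · exact (hv s c).symm

theorem removeEquiv_partner (c : PrismColour) (x : ({w : D.V // w ≠ v} ⊕ Unit) × PrismField) :
    D.removeEquiv v (x.1, prismPartner c x.2) =
      ((D.removeEquiv v x).1, prismPartner c (D.removeEquiv v x).2) := rfl

/-- A vertex with its two triangles contracted with each other is a closed snail. -/
theorem iso_union_closedSnail (hv : ∀ s c, D.contr (v, (s, c)) = (v, (!s, c))) : Iso ((D.remove v hv).union closedSnail) D :=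
  ⟨rfl, D.removeEquiv v, removeEquiv_contr hv, removeEquiv_partner⟩

/-- Inserting a snail into a propagator of the diagram with one vertex removed. -/
theorem replaceEdge_remove_iso (hv : ∀ s c, D.contr (v, (s, c)) = (v, (!s, c)))
    (y : (D.remove v hv).HalfEdge) (a : closedSnail.HalfEdge) (π : Equiv.Perm D.HalfEdge)
    (h1 : π (D.contr (y.1.1, y.2)) = (v, a.2)) (h2 : π (v, a.2) = D.contr (y.1.1, y.2))
    (h3 : ∀ x, x ≠ D.contr (y.1.1, y.2) → x ≠ (v, a.2) → π x = x) :
    Iso ((D.remove v hv).replaceEdge closedSnail y a) (D.rewire π) := by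
  classical
  refine iso_rewire (D := (D.remove v hv).union closedSnail) (D' := D) rfl
    (D.removeEquiv v) (removeEquiv_contr hv) removeEquiv_partner _ π fun x => ?_
  by_cases hx : x = left closedSnail ((D.remove v hv).contr y)
  · subst hx
    refine (congrArg (D.removeEquiv v) (Equiv.swap_apply_left
      (α := ((D.remove v hv).union closedSnail).HalfEdge) _ _)).trans ?_
    exact h1.symm
  by_cases hx' : x = right (D.remove v hv) a
  · subst hx'
    refine (congrArg (D.removeEquiv v) (Equiv.swap_apply_right
      (α := ((D.remove v hv).union closedSnail).HalfEdge) _ _)).trans ?_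
    exact h2.symm
  refine (congrArg (D.removeEquiv v) (Equiv.swap_apply_of_ne_of_ne
    (α := ((D.remove v hv).union closedSnail).HalfEdge) hx hx')).trans (h3 _ ?_ ?_).symm
  · exact fun he => hx ((D.removeEquiv v).injective he)
  · exact fun he => hx' ((D.removeEquiv v).injective he)

/-- Expanding a vertex of the diagram with one vertex removed. -/
theorem expand_remove_iso {w : D.V} (hw : ∀ s c, D.contr (w, (s, c)) = (w, (!s, c)))
    (hvw : v ≠ w) (σ : Equiv.Perm D.HalfEdge)
    (h1 : ∀ c, σ (v, (false, c)) = (w, (true, c))) (h2 : ∀ c, σ (w, (true, c)) = (v, (false, c)))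
    (h3 : ∀ c, σ (w, (false, c)) = (w, (false, c)))
    (h4 : ∀ u c, u ≠ w → σ (u, (true, c)) = (u, (true, c)))
    (h5 : ∀ u i, u ≠ v → u ≠ w → σ (u, i) = (u, i)) :
    Iso ((D.remove w hw).expand ⟨v, hvw⟩) (D.rewire σ) := by
  refine iso_rewire (D := (D.remove w hw).union closedSnail) (D' := D) rfl
    (D.removeEquiv w) (removeEquiv_contr hw) removeEquiv_partner _ σ fun x => ?_
  change D.removeEquiv w (exchange (D.remove w hw) ⟨v, hvw⟩ x) = σ (D.removeEquiv w x)
  obtain ⟨⟨u, hu⟩ | _, s, c⟩ := x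
  · by_cases huv : u = v
    · subst huv
      cases s
      · refine (congrArg (D.removeEquiv w) (exchange_left_false _ _ c)).trans ?_
        exact (h1 c).symm
      · exact (h4 u c hu).symm
    · refine (congrArg (D.removeEquiv w) (exchange_left_of_ne (D.remove w hw) _
        (fun he => huv (congrArg Subtype.val he)) (s, c))).trans ?_
      exact (h5 u _ huv hu).symm
  · cases s
    · exact (h3 c).symm
    · exact (h2 c).symm

end Remove

/-- A diagram without vertices and closed propagators is a unit for juxtaposition. -/
theorem union_iso_replaceRing (X E : PrismDiagram) [IsEmpty X.V] (hX : X.rings = 0) :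
    Iso (X.union E) (zeroCycle.replaceRing E) := by
  refine ⟨?_, Equiv.prodCongr (Equiv.sumCongr (Equiv.equivOfIsEmpty X.V Empty) (Equiv.refl _))
    (Equiv.refl _), ?_, fun _ _ => rfl⟩
  · change X.rings + E.rings = 1 - 1 + E.rings
    rw [hX]
  · rintro ⟨w | w, i⟩
    · exact isEmptyElim w
    · rfl

/-- A diagram with two rungs of a vertex contracted arises from a snail. -/
theorem exists_iso_snail {D : PrismDiagram} {v : D.V} {d : PrismColour}
    (h : ∀ s c, c ≠ d → D.contr (v, (s, c)) = (v, (!s, c))) :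
    (∃ X : PrismDiagram, Iso (X.union closedSnail) D) ∨
    ∃ (X : PrismDiagram) (y : X.HalfEdge) (a : closedSnail.HalfEdge),
      Iso (X.replaceEdge closedSnail y a) D := by
  classical
  -- If the third rung is contracted as well, the vertex is a closed component by itself and there
  -- is no propagator left to insert it into.
  by_cases hy : D.contr (v, (false, d)) = (v, (true, d))
  · left
    have hy' : D.contr (v, (true, d)) = (v, (false, d)) := by rw [← hy, D.contr_contr]
    have hv : ∀ s c, D.contr (v, (s, c)) = (v, (!s, c)) := by
      intro s c
      by_cases hc : c = d
      · subst hc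
        cases s
        · exact hy
        · exact hy'
      · exact h s c hc
    exact ⟨_, iso_union_closedSnail hv⟩
  · right
    have key : ∀ s, (D.contr (v, (s, d))).1 ≠ v := by
      intro s hs
      obtain ⟨⟨s', c⟩, hc⟩ : ∃ i, D.contr (v, (s, d)) = (v, i) := ⟨_, Prod.ext hs rfl⟩
      have hc' : D.contr (v, (s', c)) = (v, (s, d)) := by rw [← hc, D.contr_contr]
      by_cases hcd : c = d
      · subst hcd
        have h1 : s ≠ s' := by
          rintro rfl
          exact D.contr_ne _ hc
        cases s <;> cases s'
        · exact h1 rfl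
        · exact hy hc
        · exact hy hc'
        · exact h1 rfl
      · rw [h s' c hcd] at hc'
        exact hcd (congrArg (fun x => x.2.2) hc')
    set p : D.HalfEdge := (v, (false, d)) with hp
    set q : D.HalfEdge := (v, (true, d)) with hq
    have hpq : p ≠ q := by simp [hp, hq]
    have hyv : (D.contr p).1 ≠ v := key false
    have hzv : (D.contr q).1 ≠ v := key true
    -- This swap closes the vertex `v` into a closed snail and joins its two external neighbours.
    -- Being an involution, it also reinserts the snail.
    set π := Equiv.swap (D.contr q) p with hπ
    have hvz : ∀ i, (v, i) ≠ D.contr q := fun i he => hzv (congrArg Prod.fst he).symm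
    have π1 : π (D.contr q) = p := Equiv.swap_apply_left _ _
    have π2 : π p = D.contr q := Equiv.swap_apply_right _ _
    have π3 : ∀ i, (v, i) ≠ p → π (v, i) = (v, i) := fun i hi =>
      Equiv.swap_apply_of_ne_of_ne (hvz i) hi
    have π4 : π (D.contr p) = D.contr p := by
      refine Equiv.swap_apply_of_ne_of_ne (fun he => hpq ?_) (D.contr_ne p)
      rw [← D.contr_contr p, he, D.contr_contr]
    have hπs : π.symm = π := Equiv.symm_swap _ _
    have hr : ∀ x : D.HalfEdge, (D.rewire π).contr x = π (D.contr (π x)) := fun x => by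
      change π (D.contr (π.symm x)) = _
      rw [hπs]
    have hv : ∀ s c, (D.rewire π).contr (v, (s, c)) = (v, (!s, c)) := by
      intro s c
      refine (hr (v, (s, c))).trans ?_
      by_cases hc : c = d
      · subst hc
        cases s
        · exact (congrArg (fun x => π (D.contr x)) π2).trans (by
            rw [D.contr_contr]; exact π3 _ hpq.symm)
        · exact (congrArg (fun x => π (D.contr x)) (π3 _ hpq.symm)).trans π1
      · have h1 : ∀ s, (v, (s, c)) ≠ p := fun s he => hc (congrArg (fun x => x.2.2) he)
        rw [π3 _ (h1 s), h s c hc, π3 _ (h1 _)]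
    have e1 : (D.rewire π).contr (D.contr p) = D.contr q := by
      rw [hr, π4, D.contr_contr, π2]
    refine ⟨(D.rewire π).remove v hv, (⟨(D.contr p).1, hyv⟩, (D.contr p).2), ((), (false, d)),
      Iso.trans (replaceEdge_remove_iso hv _ _ π ?_ ?_ ?_)
        (D.rewire_rewire_iso π fun x => (Equiv.eq_symm_apply π).1 (by rw [hπs]))⟩
    · exact (congrArg π e1).trans π1
    · exact π2.trans e1.symm
    · intro x hx hx'
      exact Equiv.swap_apply_of_ne_of_ne (fun he => hx (he.trans e1.symm)) hx'

/-- A diagram in which the triangles of two vertices are contracted is an expansion. -/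
theorem exists_iso_expand {D : PrismDiagram} {v w : D.V} (hvw : v ≠ w)
    (h : ∀ c, D.contr (v, (false, c)) = (w, (false, c))) :
    ∃ (X : PrismDiagram) (u : X.V), Iso (X.expand u) D := by
  classical
  have h' : ∀ c, D.contr (w, (false, c)) = (v, (false, c)) := fun c => by
    rw [← h, D.contr_contr]
  -- This is the `exchange` of the expansion, carried out inside `D`: it turns `w` into a closed
  -- snail and returns its external connections to `v`.
  let σ : D.HalfEdge → D.HalfEdge := fun x =>
    if x.1 = v ∧ x.2.1 = false then (w, (true, x.2.2))
    else if x.1 = w ∧ x.2.1 = true then (v, (false, x.2.2)) else x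
  have hσ : Function.Involutive σ := by
    rintro ⟨u, s, c⟩
    by_cases h1 : u = v ∧ s = false
    · obtain ⟨rfl, rfl⟩ := h1
      simp [σ, hvw.symm]
    by_cases h2 : u = w ∧ s = true
    · obtain ⟨rfl, rfl⟩ := h2
      simp [σ, hvw.symm]
    simp [σ, h1, h2]
  have σ1 : ∀ c, σ (v, (false, c)) = (w, (true, c)) := fun c => by simp [σ]
  have σ2 : ∀ c, σ (w, (true, c)) = (v, (false, c)) := fun c => by simp [σ, hvw.symm]
  have σ3 : ∀ c, σ (w, (false, c)) = (w, (false, c)) := fun c => by simp [σ, hvw.symm]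
  have σ4 : ∀ u c, u ≠ w → σ (u, (true, c)) = (u, (true, c)) := fun u c hu => by simp [σ, hu]
  have σ5 : ∀ u i, u ≠ v → u ≠ w → σ (u, i) = (u, i) := fun u i hu hu' => by simp [σ, hu, hu']
  have hv : ∀ s c, (D.rewire hσ.toPerm).contr (w, (s, c)) = (w, (!s, c)) := by
    intro s c
    change σ (D.contr (σ (w, (s, c)))) = _
    cases s
    · rw [σ3, h', σ1]; rfl
    · rw [σ2, h, σ3]; rfl
  exact ⟨(D.rewire hσ.toPerm).remove w hv, ⟨v, hvw⟩,
    (expand_remove_iso hv hvw hσ.toPerm σ1 σ2 σ3 σ4 σ5).trans (D.rewire_rewire_iso hσ.toPerm hσ)⟩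

/-- At each vertex the two triangles may be interchanged. -/
theorem exists_iso_flip (D : PrismDiagram) (f : D.V → Bool) :
    ∃ D' : PrismDiagram, ∃ hV : D'.V = D.V, Iso D D' ∧ ∀ v w s s' c,
      D.contr (v, (s, c)) = (w, (s', c)) →
      D'.contr (cast hV.symm v, (xor s (f v), c)) = (cast hV.symm w, (xor s' (f w), c)) := by
  let σ : D.HalfEdge → D.HalfEdge := fun x => (x.1, (xor x.2.1 (f x.1), x.2.2))
  have hσ : Function.Involutive σ := fun x => by simp [σ]
  refine ⟨D.rewire hσ.toPerm, rfl, D.iso_rewire_self hσ.toPerm ?_, ?_⟩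
  · rintro c ⟨v, s, d⟩
    change σ (v, prismPartner c (s, d)) = ((σ (v, (s, d))).1, prismPartner c (σ (v, (s, d))).2)
    by_cases hd : d = c
    · subst hd
      simp [σ, prismPartner_rung]
    · simp [σ, prismPartner_of_ne hd]
  · intro v w s s' c h
    change σ (D.contr (σ (σ (v, (s, c))))) = σ (w, (s', c))
    rw [hσ, h]

theorem exists_iso_expand_of_flip {D : PrismDiagram} {v w : D.V} {s s' : Bool} (hvw : v ≠ w)
    (h : ∀ c, D.contr (v, (s, c)) = (w, (s', c))) :
    ∃ (X : PrismDiagram) (u : X.V), Iso (X.expand u) D := by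
  classical
  -- Flipping by `s` at `v` and by `s'` at `w` makes both contracted triangles the triangle `false`.
  obtain ⟨D', hV, hD, hc⟩ := D.exists_iso_flip fun u => if u = v then s else s'
  obtain ⟨X, u, hX⟩ := exists_iso_expand (D := D') (v := cast hV.symm v) (w := cast hV.symm w)
    (fun he => hvw ((cast_bijective hV.symm).injective he)) (fun c => by
      simpa [hvw.symm] using hc v w s s' c (h c))
  exact ⟨X, u, hX.trans hD.symm⟩

/-! ### Loop counts of the moves -/

theorem connected_closedSnail : closedSnail.Connected := by
  have h1 : Nat.card (Quot closedSnail.Adj) = 1 := by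
    rw [Nat.card_eq_one_iff_unique]
    refine ⟨⟨?_⟩, ⟨Quot.mk _ ()⟩⟩
    rintro ⟨_⟩ ⟨_⟩
    rfl
  rw [Connected, h1]
  rfl

theorem connected_closedMelon : closedMelon.Connected := by
  have h1 : Nat.card (Quot closedMelon.Adj) = 1 := by
    rw [Nat.card_eq_one_iff_unique]
    have key : ∀ s : Bool, Quot.mk closedMelon.Adj s = Quot.mk closedMelon.Adj false := by
      rintro (_ | _)
      · rfl
      · exact Quot.sound ⟨(false, 0), (false, 0), rfl⟩
    refine ⟨⟨?_⟩, ⟨Quot.mk _ false⟩⟩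
    rintro ⟨s⟩ ⟨t⟩
    exact (key s).trans (key t).symm
  rw [Connected, h1]
  rfl

theorem totalLoops_closedSnail : closedSnail.totalLoops = 6 := by
  have h1 := totalLoops_le connected_closedSnail
  have h2 : closedSnail.numVertices = 1 := Nat.card_unique (α := Unit)
  have h3 : ∀ c, 2 ≤ closedSnail.loops c := by
    intro c
    refine le_trans ?_ (Nat.le_add_right _ _)
    -- The loop through the rung of colour `c` and the loop through the other corners are distinct.
    -- The matching upper bound is the general one.
    let F : Quot (closedSnail.Strand c) → Bool := Quot.lift (fun x => decide (x.2.2 = c)) (by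
      rintro ⟨v, s, d⟩ y (rfl | rfl)
      · rfl
      · by_cases hd : d = c
        · subst hd; simp [prismPartner_rung]
        · simp only [prismPartner_of_ne hd, hd, neg_add_ne hd])
    have hF : Function.Surjective F := by
      rintro (_ | _)
      · exact ⟨Quot.mk _ ((), (false, c + 1)), by simp [F]⟩
      · exact ⟨Quot.mk _ ((), (false, c)), by simp [F]⟩
    simpa using Nat.card_le_card_of_surjective F hF
  have h4 := h3 0
  have h5 := h3 1
  have h6 := h3 2
  rw [totalLoops, Fin.sum_univ_three] at h1 ⊢
  omega

theorem le_totalLoops_closedMelon : 9 ≤ closedMelon.totalLoops := by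
  have h3 : ∀ c, 3 ≤ closedMelon.loops c := by
    intro c
    refine le_trans ?_ (Nat.le_add_right _ _)
    let F : Quot (closedMelon.Strand c) → Fin 3 :=
      Quot.lift (fun x => if x.2.2 = c then 0 else if x.2.1 then 1 else 2) (by
      rintro ⟨v, s, d⟩ y (rfl | rfl)
      · rfl
      · by_cases hd : d = c
        · subst hd; simp [prismPartner_rung]
        · simp only [prismPartner_of_ne hd, hd, neg_add_ne hd])
    have hF : Function.Surjective F := by
      intro i
      fin_cases i
      · exact ⟨Quot.mk _ (false, (false, c)), by simp [F]⟩
      · exact ⟨Quot.mk _ (false, (true, c + 1)), by simp [F]⟩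
      · exact ⟨Quot.mk _ (false, (false, c + 1)), by simp [F]⟩
    simpa using Nat.card_le_card_of_surjective F hF
  have h4 := h3 0
  have h5 := h3 1
  have h6 := h3 2
  rw [totalLoops, Fin.sum_univ_three]
  omega

theorem numVertices_closedSnail : closedSnail.numVertices = 1 := Nat.card_unique (α := Unit)

theorem numVertices_closedMelon : closedMelon.numVertices = 2 := by
  change Nat.card Bool = 2
  simp

theorem totalLoops_replaceEdge (D E : PrismDiagram) (h : D.HalfEdge) (a : E.HalfEdge) :
    (D.replaceEdge E h a).totalLoops + 3 = D.totalLoops + E.totalLoops := by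
  have key := fun c : PrismColour => D.count_replaceEdge E h a (Set.singleton_nonempty c)
  have h0 := key 0
  have h1 := key 1
  have h2 := key 2
  simp only [totalLoops, loops_eq_count, Fin.sum_univ_three]
  omega

theorem connected_replaceEdge {D E : PrismDiagram} (h : D.HalfEdge) (a : E.HalfEdge)
    (hE : E.Connected) : (D.replaceEdge E h a).Connected ↔ D.Connected := by
  have key := D.count_replaceEdge E h a Set.univ_nonempty
  rw [connected_iff_count] at hE ⊢
  rw [connected_iff_count]
  omega

theorem totalLoops_replaceRing (D E : PrismDiagram) (hD : 0 < D.rings) :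
    (D.replaceRing E).totalLoops + 3 = D.totalLoops + E.totalLoops := by
  have key := fun c : PrismColour => D.count_replaceRing E hD {c}
  have h0 := key 0
  have h1 := key 1
  have h2 := key 2
  simp only [totalLoops, loops_eq_count, Fin.sum_univ_three]
  omega

theorem connected_replaceRing {D E : PrismDiagram} (hD : 0 < D.rings)
    (hE : E.Connected) : (D.replaceRing E).Connected ↔ D.Connected := by
  have key := D.count_replaceRing E hD Set.univ
  rw [connected_iff_count] at hE ⊢
  rw [connected_iff_count]
  omega

theorem numVertices_replaceEdge (D E : PrismDiagram) (h : D.HalfEdge) (a : E.HalfEdge) :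
    (D.replaceEdge E h a).numVertices = D.numVertices + E.numVertices :=
  numVertices_union D E

theorem numVertices_replaceRing (D E : PrismDiagram) :
    (D.replaceRing E).numVertices = D.numVertices + E.numVertices :=
  numVertices_union D E

theorem connected_zeroCycle : zeroCycle.Connected := by
  have : IsEmpty zeroCycle.V := inferInstanceAs (IsEmpty Empty)
  have : IsEmpty (Quot zeroCycle.Adj) := ⟨by rintro ⟨v⟩; exact this.elim v⟩
  rw [Connected, Nat.card_of_isEmpty]
  rfl

theorem totalLoops_zeroCycle : zeroCycle.totalLoops = 3 := by
  have : IsEmpty zeroCycle.V := inferInstanceAs (IsEmpty Empty)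
  have h : ∀ c, IsEmpty (Quot (zeroCycle.Strand c)) := fun c =>
    ⟨by rintro ⟨x⟩; exact this.elim x.1⟩
  have h1 : ∀ c, zeroCycle.loops c = 1 := fun c => by
    have := h c
    rw [loops, Nat.card_of_isEmpty]
    rfl
  simp [totalLoops, h1]

theorem numVertices_zeroCycle : zeroCycle.numVertices = 0 := by
  change Nat.card Empty = 0
  simp

/-! ### Generated diagrams are those attaining the bound -/

/-- Each move gains at least three loops per new vertex: `6 - 3` for a snail, at least `9 - 3` for
the two vertices of a melon, and one per colour for an expansion. -/
theorem Generated.connected_and_le {D : PrismDiagram} (hD : D.Generated) :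
    D.Connected ∧ 3 + 3 * D.numVertices ≤ D.totalLoops := by
  have hM := le_totalLoops_closedMelon
  have hS := totalLoops_closedSnail
  have hM' := numVertices_closedMelon
  have hS' := numVertices_closedSnail
  induction hD with
  | zeroCycle =>
    refine ⟨connected_zeroCycle, ?_⟩
    rw [numVertices_zeroCycle, totalLoops_zeroCycle]
  | iso _ h ih => rwa [← h.connected_iff, ← h.numVertices_eq, ← h.totalLoops_eq]
  | @snail D h a _ ih =>
    refine ⟨(connected_replaceEdge h a connected_closedSnail).2 ih.1, ?_⟩
    have h1 := D.totalLoops_replaceEdge closedSnail h a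
    rw [numVertices_replaceEdge]
    omega
  | @snailRing D h _ ih =>
    refine ⟨(connected_replaceRing h connected_closedSnail).2 ih.1, ?_⟩
    have h1 := D.totalLoops_replaceRing closedSnail h
    rw [numVertices_replaceRing]
    omega
  | @melon D h a _ ih =>
    refine ⟨(connected_replaceEdge h a connected_closedMelon).2 ih.1, ?_⟩
    have h1 := D.totalLoops_replaceEdge closedMelon h a
    rw [numVertices_replaceEdge]
    omega
  | @melonRing D h _ ih =>
    refine ⟨(connected_replaceRing h connected_closedMelon).2 ih.1, ?_⟩
    have h1 := D.totalLoops_replaceRing closedMelon h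
    rw [numVertices_replaceRing]
    omega
  | @expand D v _ ih =>
    refine ⟨(connected_expand D v).2 ih.1, ?_⟩
    rw [totalLoops_expand, numVertices_expand]
    omega

/-- This makes the bound sharp for every number of vertices, so that a maximal diagram must attain
it. The first vertex has to come from a snail in the ring, as there is nothing to expand. -/
theorem exists_generated (n : ℕ) : ∃ D : PrismDiagram, D.Generated ∧ D.numVertices = n := by
  induction n with
  | zero => exact ⟨_, .zeroCycle, numVertices_zeroCycle⟩
  | succ n ih =>
    obtain ⟨D, hD, hn⟩ := ih
    rcases isEmpty_or_nonempty D.V with hV | ⟨⟨v⟩⟩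
    · refine ⟨_, .snailRing (D := zeroCycle) (Nat.one_pos) .zeroCycle, ?_⟩
      have h0 : n = 0 := by rw [← hn, numVertices, Nat.card_of_isEmpty]
      rw [numVertices_replaceRing, numVertices_zeroCycle, numVertices_closedSnail, h0]
    · refine ⟨_, .expand v hD, ?_⟩
      rw [numVertices_expand, hn]

theorem iso_zeroCycle {D : PrismDiagram} [IsEmpty D.V] (hD : D.rings = 1) : Iso zeroCycle D := by
  have : IsEmpty zeroCycle.HalfEdge := ⟨fun x => Empty.elim x.1⟩
  exact ⟨hD.symm, Equiv.equivOfIsEmpty _ _, fun x => isEmptyElim x, fun _ x => isEmptyElim x⟩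

theorem isEmpty_of_count_eq_zero {X : PrismDiagram} (h : X.count Set.univ = 0) :
    IsEmpty X.V ∧ X.rings = 0 := by
  rw [count] at h
  have h1 : finrank (ZMod 2) (X.invFun Set.univ) = 0 := by omega
  refine ⟨⟨fun v => ?_⟩, by omega⟩
  have h2 := finrank_zero_iff.1 h1
  have h3 := h2.elim ⟨fun _ => 1, fun _ => rfl, fun _ _ _ _ => rfl⟩ 0
  exact one_ne_zero (congrFun (congrArg Subtype.val h3) (v, (false, 0)))

theorem generated_of_le (n : ℕ) : ∀ D : PrismDiagram, D.numVertices = n → D.Connected →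
    3 + 3 * D.numVertices ≤ D.totalLoops → D.Generated := by
  induction n with
  | zero =>
    intro D hn hD _
    have hV : IsEmpty D.V := (Finite.card_eq_zero_iff).1 hn
    have : IsEmpty (Quot D.Adj) := ⟨by rintro ⟨v⟩; exact hV.elim v⟩
    rw [Connected, Nat.card_of_isEmpty, zero_add] at hD
    exact .iso .zeroCycle (iso_zeroCycle hD)
  | succ n ih =>
    intro D hn hD hF
    have hV : Nonempty D.V := by
      by_contra hV
      rw [not_nonempty_iff] at hV
      rw [numVertices, Nat.card_of_isEmpty] at hn
      omega
    have hsnail := totalLoops_closedSnail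
    have hsnail' := numVertices_closedSnail
    rcases exists_snail_or_expansion hD hF with ⟨v, s, d, h⟩ | ⟨v, w, s, s', hvw, h⟩
    · have h' : ∀ t c, c ≠ d → D.contr (v, (t, c)) = (v, (!t, c)) := by
        intro t c hc
        by_cases hts : t = s
        · rw [hts, h c hc]
        · have h1 : t = !s := by cases s <;> cases t <;> simp_all
          rw [h1, ← h c hc, D.contr_contr, Bool.not_not]
      rcases exists_iso_snail h' with ⟨X, hX⟩ | ⟨X, y, a, hX⟩
      -- The closed snail already accounts for the one component of `D`, so the rest `X` is empty
      -- and `D` is the snail inserted into the ring.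
      · have h1 := hX.count_eq Set.univ
        have h2 := (connected_iff_count _).1 connected_closedSnail
        rw [count_union, (connected_iff_count _).1 hD, h2] at h1
        obtain ⟨h3, h4⟩ := isEmpty_of_count_eq_zero (X := X) (by omega)
        exact .iso (.snailRing Nat.one_pos .zeroCycle)
          ((union_iso_replaceRing X closedSnail h4).symm.trans hX)
      · refine .iso (.snail y a (ih X ?_ ?_ ?_)) hX
        · have h1 := hX.numVertices_eq
          rw [numVertices_replaceEdge] at h1
          omega
        · rwa [← connected_replaceEdge y a connected_closedSnail, hX.connected_iff]
        · have h1 := hX.numVertices_eq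
          have h2 := hX.totalLoops_eq
          have h3 := X.totalLoops_replaceEdge closedSnail y a
          rw [numVertices_replaceEdge] at h1
          omega
    · obtain ⟨X, u, hX⟩ := exists_iso_expand_of_flip hvw h
      have h1 := hX.numVertices_eq
      have h2 := hX.totalLoops_eq
      rw [numVertices_expand] at h1
      rw [totalLoops_expand] at h2
      refine .iso (.expand u (ih X (by omega) ?_ (by omega))) hX
      rwa [← connected_expand X u, hX.connected_iff]

end PrismDiagram

theorem mainTheorem7 (D : PrismDiagram) : D.IsMaximal ↔ D.Generated := by
  constructor
  · rintro ⟨hD, hmax⟩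
    obtain ⟨E, hE, hn⟩ := PrismDiagram.exists_generated D.numVertices
    obtain ⟨h1, h2⟩ := hE.connected_and_le
    have h3 := hmax E h1 hn
    exact PrismDiagram.generated_of_le _ D rfl hD (by rw [← hn]; exact h2.trans h3)
  · intro hD
    obtain ⟨h1, h2⟩ := hD.connected_and_le
    refine ⟨h1, fun E hE hn => ?_⟩
    have h3 := PrismDiagram.totalLoops_le hE
    rw [hn] at h3
    exact h3.trans h2
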